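/- Let $F$ be a real function, smooth on $(0,\infty)$, and let $0<r_-<r_+$ be such that $F>0$ on $(r_+,\infty)$, $F<0$ on $(r_-,r_+)$, $F>0$ on $(0,r_-)$, $F'(r_+)>0$ and $F'(r_-)<0$. Put $\kappa_\pm=F'(r_\pm)/2$, so that $\kappa_-<0<\kappa_+$. Consider the $1+1$ generalised non-extremal Reissner–Nordström spacetime with metric $-F\,dt^2+F^{-1}dr^2=-F\,dv^2+2\,dv\,dr$, where $v=t+r^*$ and $dr^*=dr/F$; the part $r>r_-$ of the chart $(v,r)$ is the union of the exterior region, the future event horizon $r=r_+$ and the black hole region, with $-\partial_r$ future-directed, and $r=r_-$ is the left part of the future Cauchy horizon. On this part let $V=e^{\kappa_+v}$ and let $U$ be the other Kruskal coordinate ($U=-e^{-\kappa_+(t-r^*)}$ in the exterior, extended smoothly through $r=r_+$, and positive in the black hole region), so that $UV=(r_+-r)\exp\int_{r_+}^{r}\big(\tfrac{2\kappa_+}{F(y)}-\tfrac1{y-r_+}\big)dy$. The Hartle–Hawking–Israel (HHI) and Unruh states of the massless scalar field have the two-point functions ($\delta\to0^+$, with $c$ an arbitrary real constant) $$\mathcal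 W_{\rm H}=-\tfrac1{4\pi}\ln[(\delta+i\Delta U)(\delta+i\Delta V)]+c,\qquad \mathcal W_{\rm U}=-\tfrac1{4\pi}\ln[(\delta+i\Delta U)(\delta+i\Delta v)]+c .$$ For a worldline $x(\tau)$ parametrised by proper time let $\mathcal A(\tau',\tau'')=\partial_{\tau'}\partial_{\tau''}\mathcal W(x(\tau'),x(\tau''))$. The transition rate at time $\tau$ of a derivative-coupling detector with energy gap $E\in\mathbb R$, sharply switched on at time $\tau_0<\tau$, is $$\dot{\mathcal F}(E,\tau,\tau_0)=-\frac E2+2\int_0^{\tau-\tau_0}\!ds\,\mathrm{Re}\Big[e^{-iEs}\mathcal A(\tau,\tau-s)+\frac1{2\pi s^2}\Big]+\frac1{\pi(\tau-\tau_0)} .$$ Let $x(\tau)$, $\tau\in(a,\tau_h)$, be a future-directed timelike geodesic, parametrised by proper time, in the union of the exterior region, the future event horizon and the black hole region, which is left-moving, i.e. has Killing energy $\varepsilon=-g(\partial_v,\dot x)>0$ (so $\dot t=\varepsilon/F$ and $\dot r^2=\varepsilon^2-F$), and which approaches the Cauchy horizon: $r(\tau)\to r_-$ as $\tau\to\tau_h^-$.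 Then for every $E\in\mathbb R$ and every fixed switch-on time $\tau_0\in(a,\tau_h)$, both in the HHI state and in the Unruh state, the integral defining $\dot{\mathcal F}(E,\tau,\tau_0)$ converges absolutely for $\tau$ close to $\tau_h$, and $$\dot{\mathcal F}(E,\tau,\tau_0)=-\frac1{4\pi}\Big(1+\frac{\kappa_+}{\kappa_-}+o(1)\Big)\frac1{\tau_h-\tau}\qquad(\tau\to\tau_h^-).$$ In particular the leading coefficient does not depend on $\varepsilon$, on the initial data of the geodesic, on $\tau_0$ or on $E$. -/

import Mathlib

/-- Data of a generalised `1+1` non-extremal Reissner–Nordström spacetime: the metric function `F`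
of `-F dt² + F⁻¹ dr²`, smooth on `(0, ∞)`, with simple zeros exactly at `0 < rm < rp` and with the
sign pattern of the non-extremal Reissner–Nordström solution. -/
structure GenRN where
  /-- the metric function -/
  F : ℝ → ℝ
  /-- the inner (Cauchy) horizon radius `r₋` -/
  rm : ℝ
  /-- the outer (event) horizon radius `r₊` -/
  rp : ℝ
  rm_pos : 0 < rm
  rm_lt_rp : rm < rp
  smooth : ContDiffOn ℝ ((⊤ : ℕ∞) : WithTop ℕ∞) F (Set.Ioi 0)
  pos_exterior : ∀ r, rp < r → 0 < F r
  neg_between : ∀ r, rm < r → r < rp → F r < 0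
  pos_inner : ∀ r, 0 < r → r < rm → 0 < F r
  deriv_rp_pos : 0 < deriv F rp
  deriv_rm_neg : deriv F rm < 0

namespace GenRN

noncomputable section

/-- Surface gravity of the outer horizon, `κ₊ = F'(r₊)/2 > 0`. -/
def kappaP (S : GenRN) : ℝ := deriv S.F S.rp / 2

/-- Surface gravity of the inner horizon, `κ₋ = F'(r₋)/2 < 0`. -/
def kappaM (S : GenRN) : ℝ := deriv S.F S.rm / 2

/-! ### Ingoing Eddington–Finkelstein chart

An event is a pair `(v, r)`, `v = t + r*`, `dr* = dr/F`.  The metric is `-F dv² + 2 dv dr`.  The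
part `r > r₋` of this chart is the union of region I (`r > r₊`), of the future event horizon
(`r = r₊`) and of the black hole region II (`r₋ < r < r₊`).  The left part of the future
Cauchy horizon is the set `r = r₋` of this chart.  The time orientation is the one for which the
null vector `-∂_r` is future-directed. -/

/-- The metric at radius `r`, in the chart `(v, r)`, on tangent vectors `X = (Xᵛ, Xʳ)` and `Y`. -/
def metric (S : GenRN) (r : ℝ) (X Y : ℝ × ℝ) : ℝ :=
  -S.F r * (X.1 * Y.1) + X.1 * Y.2 + X.2 * Y.1

/-- The components of the tangent vector of a worldline. -/
def velocity (x : ℝ → ℝ × ℝ) (τ : ℝ) : ℝ × ℝ :=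
  (deriv (fun t => (x t).1) τ, deriv (fun t => (x t).2) τ)

/-- The geodesic equation at parameter value `τ`, for the metric `-F dv² + 2 dv dr`, whose nonzero
Christoffel symbols are `Γᵛ_vv = F'/2`, `Γʳ_vv = F F'/2`, `Γʳ_vr = Γʳ_rv = -F'/2`. -/
structure GeodesicEqAt (S : GenRN) (x : ℝ → ℝ × ℝ) (τ : ℝ) : Prop where
  diff_v : DifferentiableAt ℝ (fun t => (x t).1) τ
  diff_r : DifferentiableAt ℝ (fun t => (x t).2) τ
  eq_v : HasDerivAt (fun t => (velocity x t).1)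
    (-(deriv S.F (x τ).2 / 2) * (velocity x τ).1 ^ 2) τ
  eq_r : HasDerivAt (fun t => (velocity x t).2)
    (-(S.F (x τ).2 * deriv S.F (x τ).2 / 2) * (velocity x τ).1 ^ 2
      + deriv S.F (x τ).2 * (velocity x τ).1 * (velocity x τ).2) τ

/-- `x` is, for proper time in `(a, τh)`, a future-directed timelike geodesic parametrised by proper
time, in the union of region I, the event horizon and region II, with Killing energy
`ε = -g(∂_v, ẋ)`, and it reaches the left part of the future Cauchy horizon at `τh`.
It is left-moving when `0 < ε`.  For `r ≠ r₊` one has `ṫ = ε/F` and `ṙ² = ε² - F`. -/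
structure IsGeodesicToCauchyHorizon (S : GenRN) (ε a τh : ℝ) (x : ℝ → ℝ × ℝ) : Prop where
  region : ∀ τ ∈ Set.Ioo a τh, S.rm < (x τ).2
  geodesic : ∀ τ ∈ Set.Ioo a τh, S.GeodesicEqAt x τ
  proper_time : ∀ τ ∈ Set.Ioo a τh, S.metric (x τ).2 (velocity x τ) (velocity x τ) = -1
  future : ∀ τ ∈ Set.Ioo a τh, S.metric (x τ).2 (0, -1) (velocity x τ) < 0
  energy : ∀ τ ∈ Set.Ioo a τh, -S.metric (x τ).2 (1, 0) (velocity x τ) = ε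
  approach : Filter.Tendsto (fun τ => (x τ).2) (nhdsWithin τh (Set.Iio τh)) (nhds S.rm)

/-! ### Kruskal coordinates -/

/-- The product `U V` of the Kruskal coordinates, as a function of `r > r₋`.  It solves
`F G' = 2 κ₊ G`, so it is `-exp (2 κ₊ r*)` for `r > r₊` and `exp (2 κ₊ r*)` for `r₋ < r < r₊`, with
the additive constants of the tortoise coordinate `r*` such that it is smooth through
`r = r₊`.  The integrand has a removable singularity at `r₊`. -/
def kruskalProduct (S : GenRN) (r : ℝ) : ℝ :=
  (S.rp - r) * Real.exp (∫ y in S.rp..r, (2 * S.kappaP / S.F y - 1 / (y - S.rp)))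

/-- `V = exp (κ₊ v)`. -/
def kruskalV (S : GenRN) (p : ℝ × ℝ) : ℝ := Real.exp (S.kappaP * p.1)

/-- `U = (U V) / V`; it is `-exp (-κ₊ u)`, `u = t - r*`, in region I, and is positive in
region II. -/
def kruskalU (S : GenRN) (p : ℝ × ℝ) : ℝ := S.kruskalProduct p.2 * Real.exp (-(S.kappaP * p.1))

/-! ### Conformal vacua -/

/-- The regularised two-point function `-(1/4π) ln[(δ + i ΔX)(δ + i ΔY)] + c` of the massless field
in the vacuum state defined by a pair of null coordinates `X`, `Y`, as a function of the coordinate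
differences; `c` is the infrared ambiguity and `δ > 0` the regulator. -/
def vacuumTwoPointReg (c δ dX dY : ℝ) : ℂ :=
  -(1 / (4 * (Real.pi : ℂ))) *
    Complex.log (((δ : ℂ) + Complex.I * dX) * ((δ : ℂ) + Complex.I * dY)) + c

/-- The limit `δ → 0⁺` of `vacuumTwoPointReg` when neither coordinate difference vanishes. -/
def vacuumTwoPoint (c dX dY : ℝ) : ℂ :=
  -(1 / (4 * (Real.pi : ℂ))) *
    (Complex.log (Complex.I * dX) + Complex.log (Complex.I * dY)) + c

theorem tendsto_vacuumTwoPointReg (c dX dY : ℝ) (hX : dX ≠ 0) (hY : dY ≠ 0) :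
    Filter.Tendsto (fun δ : ℝ => vacuumTwoPointReg c δ dX dY)
      (nhdsWithin 0 (Set.Ioi 0)) (nhds (vacuumTwoPoint c dX dY)) := by
  have key : ∀ d : ℝ, d ≠ 0 → Filter.Tendsto
      (fun δ : ℝ => Complex.log ((δ : ℂ) + Complex.I * d))
      (nhdsWithin 0 (Set.Ioi 0)) (nhds (Complex.log (Complex.I * d))) := by
    intro d hd
    have h1 : Filter.Tendsto (fun δ : ℝ => (δ : ℂ) + Complex.I * d)
        (nhdsWithin 0 (Set.Ioi 0)) (nhds (Complex.I * d)) := by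
      have : Continuous (fun δ : ℝ => (δ : ℂ) + Complex.I * d) := by fun_prop
      have h2 := this.tendsto 0
      simp only [Complex.ofReal_zero, zero_add] at h2
      exact h2.mono_left nhdsWithin_le_nhds
    refine h1.clog ?_
    rw [Complex.mem_slitPlane_iff]
    right
    simpa using hd
  have harg : ∀ δ d : ℝ, 0 < δ → |Complex.arg ((δ : ℂ) + Complex.I * d)| < Real.pi / 2 := by
    intro δ d hδ
    rw [Complex.abs_arg_lt_pi_div_two_iff]
    left
    simpa using hδ
  unfold vacuumTwoPoint
  refine Filter.Tendsto.congr' ?_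
    ((((key dX hX).add (key dY hY)).const_mul (-(1 / (4 * (Real.pi : ℂ))))).add_const (c : ℂ))
  filter_upwards [self_mem_nhdsWithin] with δ hδ
  have hne : ∀ d : ℝ, (δ : ℂ) + Complex.I * d ≠ 0 := by
    intro d h
    have := congrArg Complex.re h
    simp at this
    exact (ne_of_gt hδ) this
  have h1 := abs_lt.mp (harg δ dX hδ)
  have h2 := abs_lt.mp (harg δ dY hδ)
  unfold vacuumTwoPointReg
  rw [Complex.log_mul (hne dX) (hne dY)]
  constructor <;> linarith [h1.1, h1.2, h2.1, h2.2]

/-- Two-point function of the Hartle–Hawking–Israel state: the null coordinates are `U` and `V`. -/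
def wightmanHHI (S : GenRN) (c : ℝ) (p q : ℝ × ℝ) : ℂ :=
  vacuumTwoPoint c (S.kruskalU p - S.kruskalU q) (S.kruskalV p - S.kruskalV q)

/-- Two-point function of the Unruh state: the null coordinates are `U` and `v`. -/
def wightmanUnruh (S : GenRN) (c : ℝ) (p q : ℝ × ℝ) : ℂ :=
  vacuumTwoPoint c (S.kruskalU p - S.kruskalU q) (p.1 - q.1)

/-! ### The derivative-coupling detector -/

/-- `𝒜(τ', τ'') = ∂_{τ'} ∂_{τ''} W(x(τ'), x(τ''))`, for a two-point function `W` and a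
worldline `x`; it is used for `τ'' < τ'` only. -/
def detectorCorrelation (W : ℝ × ℝ → ℝ × ℝ → ℂ) (x : ℝ → ℝ × ℝ) (τ₁ τ₂ : ℝ) : ℂ :=
  deriv (fun a => deriv (fun b => W (x a) (x b)) τ₂) τ₁

/-- `Re[e^{-iEs} 𝒜(τ, τ - s) + 1/(2π s²)]`. -/
def rateIntegrand (W : ℝ × ℝ → ℝ × ℝ → ℂ) (x : ℝ → ℝ × ℝ) (E τ s : ℝ) : ℝ :=
  (Complex.exp (-(Complex.I * E * s)) * detectorCorrelation W x τ (τ - s)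
    + 1 / (2 * (Real.pi : ℂ) * (s : ℂ) ^ 2)).re

/-- The instantaneous transition rate `Ḟ(E, τ, τ₀)`, at proper time `τ`, of a derivative-coupling
detector with energy gap `E`, sharply switched on at proper time `τ₀`. -/
def transitionRate (W : ℝ × ℝ → ℝ × ℝ → ℂ) (x : ℝ → ℝ × ℝ) (E τ τ₀ : ℝ) : ℝ :=
  -(E / 2) + 2 * (∫ s in (0 : ℝ)..(τ - τ₀), rateIntegrand W x E τ s) + 1 / (Real.pi * (τ - τ₀))

/-- The transition rate is given by an absolutely convergent integral for `τ` close to `τh`, and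
`Ḟ(E, τ, τ₀) = -(1/4π) (1 + κ₊/κ₋ + o(1)) / (τh - τ)` as `τ → τh⁻`. -/
def HasCauchyHorizonRate (S : GenRN) (W : ℝ × ℝ → ℝ × ℝ → ℂ) (x : ℝ → ℝ × ℝ)
    (E τ₀ τh : ℝ) : Prop :=
  (∀ᶠ τ in nhdsWithin τh (Set.Iio τh),
    IntervalIntegrable (rateIntegrand W x E τ) MeasureTheory.volume 0 (τ - τ₀)) ∧
  ∃ η : ℝ → ℝ, Filter.Tendsto η (nhdsWithin τh (Set.Iio τh)) (nhds 0) ∧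
    ∀ τ ∈ Set.Ioo τ₀ τh, transitionRate W x E τ τ₀ =
      -(1 / (4 * Real.pi)) * (1 + S.kappaP / S.kappaM + η τ) * (1 / (τh - τ))

end

end GenRN

/-! Both two-point functions are sums of logarithms of the differences of two null coordinates, so
the correlation is real and equals `-(1/4π)` times the sum of the kernels `k_X(τ,s) = X'(τ) X'(τ-s)
/ (X(τ) - X(τ-s))²` (`detectorCorrelation_vacuumTwoPoint`). The counterterm `1/(2πs²)` splits evenly
between the two coordinates, and each contributes a multiple of `∫ (cos(Es) k_X - 1/s²) ds`.

For `E = 0` this integral is elementary, since `k_X` is the `s`-derivative of `-X'(τ)/(X(τ) -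
X(τ-s))`: `integral_nullKernel_sub` gives `X''/(2X') - X'/(X(τ) - X(τ₀)) + 1/(τ-τ₀)`. If `(b-τ)
X'/(X - X(t)) → α` for every `t` and `(b-τ) X''/X' → β`, then `b-τ` times the integral tends to `β/2
- α`. The energy gap does not matter: `1 - cos(Es)` suppresses the kernel at small `s`, and at fixed
positive distance from `τ` the kernel has too little mass (`tendsto_integral_cos_mul_nullKernel`).

It remains to find `α` and `β`. Along the geodesic put `q = F v̇`. Then `q' = -F'/2`
(`hasDerivAt_F_mul_velocity`) and `q → 0`, so `q ~ κ₋ (b-τ)` (`tendsto_sub_div_F_mul_velocity`).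
Beyond the event horizon `U' = -κ₊ U / q` and `U''/U' = (F'/2 - κ₊)/q`; hence `U → ∞`, `α = -κ₊/κ₋`,
`β = 1 - κ₊/κ₋` and `β/2 - α = (1 + κ₊/κ₋)/2`. The coordinates `v` and `V` are regular at this
Cauchy horizon, so `α = β = 0` for them, and the two states share the leading term. -/

open Set Filter Topology MeasureTheory

/-! ### The kernel of one null coordinate near coincidence. -/

/-- Second-order expansion of a primitive and of its derivative, to the left of a point where the
second derivative is differentiable. -/
theorem taylor_bound_left {X X1 X2 : ℝ → ℝ} {τ : ℝ}
    (h1 : ∀ᶠ t in 𝓝 τ, HasDerivAt X (X1 t) t) (h2 : ∀ᶠ t in 𝓝 τ, HasDerivAt X1 (X2 t) t)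
    (h3 : DifferentiableAt ℝ X2 τ) :
    ∃ M η : ℝ, 0 ≤ M ∧ 0 < η ∧ ∀ s ∈ Icc 0 η,
      |X1 (τ - s) - (X1 τ - X2 τ * s)| ≤ M * s ^ 2 ∧
      |X τ - X (τ - s) - (X1 τ * s - X2 τ / 2 * s ^ 2)| ≤ M * s ^ 3 := by
  obtain ⟨M, hM, hO⟩ := h3.hasDerivAt.isBigO_sub.exists_nonneg
  rw [Asymptotics.isBigOWith_iff] at hO
  obtain ⟨η, hη, hball⟩ := Metric.eventually_nhds_iff.1 (h1.and (h2.and hO))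
  have hb : ∀ s ∈ Icc 0 (η / 2), HasDerivAt X (X1 (τ - s)) (τ - s) ∧
      HasDerivAt X1 (X2 (τ - s)) (τ - s) ∧ |X2 (τ - s) - X2 τ| ≤ M * s := by
    intro s hs
    have hd : dist (τ - s) τ < η := by
      rw [Real.dist_eq, show τ - s - τ = -s by ring, abs_neg, abs_of_nonneg hs.1]
      linarith [hs.2]
    obtain ⟨a1, a2, a3⟩ := hball hd
    refine ⟨a1, a2, ?_⟩
    rwa [Real.norm_eq_abs, Real.norm_eq_abs, show τ - s - τ = -s by ring, abs_neg,
      abs_of_nonneg hs.1] at a3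
  have hsub : ∀ s : ℝ, HasDerivAt (fun s : ℝ => τ - s) (-1) s := fun s => by
    simpa using (hasDerivAt_id s).const_sub τ
  -- The Lipschitz bound of `X2` at `τ` is integrated by the mean value inequality on `[0, s]`, here
  -- once and below a second time; the constant `M` is kept and is not sharp.
  have hX1 : ∀ s ∈ Icc 0 (η / 2), |X1 (τ - s) - (X1 τ - X2 τ * s)| ≤ M * s ^ 2 := by
    intro s hs
    have key := norm_image_sub_le_of_norm_deriv_le_segment'
      (f := fun s => X1 (τ - s) - (X1 τ - X2 τ * s))
      (f' := fun s => -(X2 (τ - s) - X2 τ)) (a := 0) (b := s) (C := M * s)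
      (fun y hy => by
        have hy' : y ∈ Icc 0 (η / 2) := ⟨hy.1, hy.2.trans hs.2⟩
        have e1 := (hb y hy').2.1.comp y (hsub y)
        have e2 := (((hasDerivAt_id y).const_mul (X2 τ)).const_sub (X1 τ))
        refine (HasDerivAt.congr_deriv (e1.sub e2) ?_).hasDerivWithinAt
        simp; ring)
      (fun y hy => by
        have hy' : y ∈ Icc 0 (η / 2) := ⟨hy.1, hy.2.le.trans hs.2⟩
        rw [norm_neg, Real.norm_eq_abs]
        exact (hb y hy').2.2.trans (mul_le_mul_of_nonneg_left hy.2.le hM))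
      s ⟨hs.1, le_rfl⟩
    simp only [Real.norm_eq_abs, sub_zero, mul_zero, sub_self] at key
    linarith [key, show M * s * s = M * s ^ 2 by ring]
  refine ⟨M, η / 2, hM, by positivity, fun s hs => ⟨hX1 s hs, ?_⟩⟩
  have key := norm_image_sub_le_of_norm_deriv_le_segment'
    (f := fun s => X τ - X (τ - s) - (X1 τ * s - X2 τ / 2 * s ^ 2))
    (f' := fun s => X1 (τ - s) - (X1 τ - X2 τ * s)) (a := 0) (b := s) (C := M * s ^ 2)
    (fun y hy => by
      have hy' : y ∈ Icc 0 (η / 2) := ⟨hy.1, hy.2.trans hs.2⟩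
      have e1 := ((hb y hy').1.comp y (hsub y)).const_sub (X τ)
      have e2 := ((hasDerivAt_id y).const_mul (X1 τ)).sub
        (((hasDerivAt_id y).pow 2).const_mul (X2 τ / 2))
      refine (HasDerivAt.congr_deriv (e1.sub e2) ?_).hasDerivWithinAt
      simp; ring)
    (fun y hy => by
      have hy' : y ∈ Icc 0 (η / 2) := ⟨hy.1, hy.2.le.trans hs.2⟩
      rw [Real.norm_eq_abs]
      exact (hX1 y hy').trans (mul_le_mul_of_nonneg_left (pow_le_pow_left₀ hy.1 hy.2.le 2) hM))
    s ⟨hs.1, le_rfl⟩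
  simp only [Real.norm_eq_abs, sub_zero, mul_zero, sub_self] at key
  have e : M * s ^ 2 * s = M * s ^ 3 := by ring
  rw [e] at key
  simpa using key

/-- The kernel `X'(τ) X'(τ - s) / (X(τ) - X(τ - s))²` of a null coordinate `X` along a worldline,
`X1` being the derivative of `X`. -/
noncomputable def nullKernel (X X1 : ℝ → ℝ) (τ s : ℝ) : ℝ :=
  X1 τ * X1 (τ - s) / (X τ - X (τ - s)) ^ 2

/-- With `X' = c - 2ds + O(s²)` and `ΔX = s (c - ds + O(s²))`, numerator and denominator of `s² k_X`
agree through order `s`, so the singularity is exactly `1/s²`, with no `1/s` term. -/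
theorem nullKernel_sub_bounded {X X1 X2 : ℝ → ℝ} {τ : ℝ}
    (h1 : ∀ᶠ t in 𝓝 τ, HasDerivAt X (X1 t) t) (h2 : ∀ᶠ t in 𝓝 τ, HasDerivAt X1 (X2 t) t)
    (h3 : DifferentiableAt ℝ X2 τ) (hpos : 0 < X1 τ) :
    ∃ C η : ℝ, 0 < η ∧ ∀ s ∈ Ioc 0 η, |nullKernel X X1 τ s - 1 / s ^ 2| ≤ C := by
  obtain ⟨M, η, hM, hη, hT⟩ := taylor_bound_left h1 h2 h3
  set c := X1 τ
  set d := X2 τ / 2 with hd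
  have hD : 0 < |d| + M + 1 := by positivity
  -- The bound `1` gives `|P| ≤ |d| + M`; the last entry then keeps the denominator factor `c + P s`
  -- above `c / 2`.
  set η' := min (min η 1) (c / (2 * (|d| + M + 1))) with hη'
  have hη'pos : 0 < η' := by positivity
  refine ⟨(c * M + (|d| + M) ^ 2 + 2 * c * M) / (c / 2) ^ 2, η', hη'pos, fun s hs => ?_⟩
  have hs0 := hs.1
  have hs1 : s ≤ 1 := hs.2.trans ((min_le_left _ _).trans (min_le_right _ _))
  have hsη : s ≤ η := hs.2.trans ((min_le_left _ _).trans (min_le_left _ _))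
  have hs2 : s * (|d| + M + 1) ≤ c / 2 := by
    have := hs.2.trans (min_le_right _ _)
    rw [le_div_iff₀ (by positivity)] at this
    linarith
  obtain ⟨t1, t2⟩ := hT s ⟨hs0.le, hsη⟩
  obtain ⟨R1, hR1⟩ : ∃ R, X1 (τ - s) = c - 2 * d * s + R * s ^ 2 ∧ |R| ≤ M := by
    refine ⟨(X1 (τ - s) - (c - X2 τ * s)) / s ^ 2, ?_, ?_⟩
    · field_simp; rw [hd]; ring
    · rw [abs_div, abs_of_pos (show 0 < s ^ 2 by positivity)]
      exact (div_le_iff₀ (by positivity)).2 t1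
  obtain ⟨R2, hR2⟩ : ∃ R, X τ - X (τ - s) = c * s - d * s ^ 2 + R * s ^ 3 ∧ |R| ≤ M := by
    refine ⟨(X τ - X (τ - s) - (c * s - d * s ^ 2)) / s ^ 3, ?_, ?_⟩
    · field_simp; ring
    · rw [abs_div, abs_of_pos (show 0 < s ^ 3 by positivity)]
      exact (div_le_iff₀ (by positivity)).2 t2
  set P := -d + R2 * s with hP
  have hPb : |P| ≤ |d| + M := by
    calc |P| ≤ |-d| + |R2 * s| := abs_add_le _ _
      _ = |d| + |R2| * s := by rw [abs_neg, abs_mul, abs_of_pos hs0]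
      _ ≤ |d| + M * 1 := by gcongr; exact hR2.2
      _ = _ := by ring
  have hw : X τ - X (τ - s) = s * (c + P * s) := by rw [hR2.1, hP]; ring
  have hlow : c / 2 ≤ c + P * s := by
    have : -(P * s) ≤ (|d| + M) * s := by
      calc -(P * s) ≤ |P * s| := neg_le_abs _
        _ = |P| * s := by rw [abs_mul, abs_of_pos hs0]
        _ ≤ _ := by gcongr
    nlinarith
  have hlow0 : 0 < c + P * s := by linarith
  have hexp : nullKernel X X1 τ s - 1 / s ^ 2 =
      (c * R1 - P ^ 2 - 2 * c * R2) / (c + P * s) ^ 2 := by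
    unfold nullKernel
    rw [hw, hR1.1, hP]
    rw [hP] at hlow0
    have h1 := hlow0.ne'
    have h2 := hs0.ne'
    rw [div_sub_div _ _ (by positivity) (by positivity), div_eq_div_iff (by positivity)
      (by positivity)]
    ring
  rw [hexp, abs_div, abs_of_pos (show 0 < (c + P * s) ^ 2 by positivity)]
  have hnum : |c * R1 - P ^ 2 - 2 * c * R2| ≤ c * M + (|d| + M) ^ 2 + 2 * c * M := by
    calc |c * R1 - P ^ 2 - 2 * c * R2| ≤ |c * R1| + |P ^ 2| + |2 * c * R2| :=
          (abs_sub _ _).trans (add_le_add_left (abs_sub _ _) _)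
      _ = c * |R1| + |P| ^ 2 + 2 * c * |R2| := by
          rw [abs_mul, abs_mul, abs_mul, abs_of_pos hpos, abs_pow, abs_two]
      _ ≤ _ := by gcongr <;> first | exact hR1.2 | exact hR2.2
  gcongr

/-- The value at `s = 0` of the antiderivative of `k_X - 1/s²`; it produces the term `X''/(2X')` of
the rate. -/
theorem tendsto_inv_sub_left {X X1 X2 : ℝ → ℝ} {τ : ℝ}
    (h1 : ∀ᶠ t in 𝓝 τ, HasDerivAt X (X1 t) t) (h2 : ∀ᶠ t in 𝓝 τ, HasDerivAt X1 (X2 t) t)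
    (h3 : DifferentiableAt ℝ X2 τ) (hpos : 0 < X1 τ) :
    Tendsto (fun s => 1 / s - X1 τ / (X τ - X (τ - s))) (𝓝[>] 0)
      (𝓝 (-(X2 τ / (2 * X1 τ)))) := by
  obtain ⟨M, η, hM, hη, hT⟩ := taylor_bound_left h1 h2 h3
  set w : ℝ → ℝ := fun s => X τ - X (τ - s) with hw
  have hsmall : Tendsto (fun s => (w s - (X1 τ * s - X2 τ / 2 * s ^ 2)) / s ^ 2) (𝓝[>] 0)
      (𝓝 0) := by
    have hlim : Tendsto (fun s : ℝ => M * s) (𝓝[>] 0) (𝓝 0) := by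
      have : Tendsto (fun s : ℝ => M * s) (𝓝 0) (𝓝 (M * 0)) := by
        exact (continuous_const.mul continuous_id).tendsto 0
      rw [mul_zero] at this
      exact this.mono_left nhdsWithin_le_nhds
    refine squeeze_zero_norm' ?_ hlim
    filter_upwards [Ioc_mem_nhdsGT hη] with s hs
    have hs0 := hs.1
    rw [Real.norm_eq_abs, abs_div, abs_of_pos (show 0 < s ^ 2 by positivity),
      div_le_iff₀ (by positivity)]
    calc _ ≤ M * s ^ 3 := (hT s ⟨hs0.le, hs.2⟩).2
      _ = _ := by ring
  have hid : Tendsto (fun s : ℝ => s) (𝓝[>] 0) (𝓝 0) := nhdsWithin_le_nhds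
  have hslope : Tendsto (fun s => w s / s) (𝓝[>] 0) (𝓝 (X1 τ)) := by
    have := ((hsmall.mul hid).add (tendsto_const_nhds (x := X1 τ))).sub (hid.const_mul (X2 τ / 2))
    simp only [mul_zero, zero_add, sub_zero] at this
    refine this.congr' ?_
    filter_upwards [self_mem_nhdsWithin] with s hs
    have : s ≠ 0 := (ne_of_gt hs)
    field_simp
    ring
  have h0 := (hsmall.sub (tendsto_const_nhds (x := X2 τ / 2))).div hslope hpos.ne'
  have e : (0 - X2 τ / 2) / X1 τ = -(X2 τ / (2 * X1 τ)) := by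
    have := hpos.ne'
    field_simp; ring
  rw [e] at h0
  refine h0.congr' ?_
  filter_upwards [self_mem_nhdsWithin, hslope.eventually (lt_mem_nhds hpos)] with s hs hs'
  have hs0 : s ≠ 0 := (ne_of_gt hs)
  have hw0 : w s ≠ 0 := by
    rintro h
    rw [h, zero_div] at hs'
    exact lt_irrefl _ hs'
  change _ = 1 / s - X1 τ / w s
  simp only [Pi.div_apply]
  field_simp
  ring

theorem intervalIntegrable_of_continuousOn_Ioc {f : ℝ → ℝ} {C D η : ℝ} (hη : 0 < η)
    (hD : 0 ≤ D) (hf : ContinuousOn f (Ioc 0 D)) (hb : ∀ s ∈ Ioc 0 η, |f s| ≤ C) :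
    IntervalIntegrable f volume 0 D := by
  obtain ⟨C', hC'⟩ := (isCompact_Icc (a := η) (b := D)).exists_bound_of_continuousOn
    (hf.mono fun s hs => ⟨hη.trans_le hs.1, hs.2⟩)
  rw [intervalIntegrable_iff_integrableOn_Ioc_of_le hD]
  refine IntegrableOn.of_bound (C := max C C') (by simp)
    (hf.aestronglyMeasurable measurableSet_Ioc) ?_
  refine (ae_restrict_iff' measurableSet_Ioc).2 (Eventually.of_forall fun s hs => ?_)
  rcases le_total s η with h | h
  · exact (hb s ⟨hs.1, h⟩).trans (le_max_left _ _)
  · exact (hC' s ⟨h, hs.2⟩).trans (le_max_right _ _)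

theorem one_sub_cos_mul_le (E s : ℝ) : 1 - Real.cos (E * s) ≤ E ^ 2 / 2 * s ^ 2 := by
  have := Real.one_sub_sq_div_two_le_cos (x := E * s)
  nlinarith

/-! ### Exact integral of the kernel and the effect of the energy gap. -/

section Kernel

variable {X X1 X2 : ℝ → ℝ} {a b τ τ₀ : ℝ}

theorem strictMonoOn_of_hasDerivAt_pos (h1 : ∀ t ∈ Ioo a b, HasDerivAt X (X1 t) t)
    (hpos : ∀ t ∈ Ioo a b, 0 < X1 t) : StrictMonoOn X (Ioo a b) := by
  refine strictMonoOn_of_deriv_pos (convex_Ioo a b)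
    (fun t ht => (h1 t ht).continuousAt.continuousWithinAt) fun t ht => ?_
  rw [interior_Ioo] at ht
  rw [(h1 t ht).deriv]
  exact hpos t ht

theorem sub_mem_Ioo_of_mem_Ioc (hτ₀ : a < τ₀) (hτ : τ < b) {s : ℝ}
    (hs : s ∈ Ioc 0 (τ - τ₀)) : τ - s ∈ Ioo a b :=
  ⟨by linarith [hs.2], by linarith [hs.1]⟩

theorem sub_pos_of_mem_Ioc (h1 : ∀ t ∈ Ioo a b, HasDerivAt X (X1 t) t)
    (hpos : ∀ t ∈ Ioo a b, 0 < X1 t) (hτ₀ : a < τ₀) (hτ : τ ∈ Ioo a b) {s : ℝ}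
    (hs : s ∈ Ioc 0 (τ - τ₀)) : 0 < X τ - X (τ - s) :=
  sub_pos.2 (strictMonoOn_of_hasDerivAt_pos h1 hpos (sub_mem_Ioo_of_mem_Ioc hτ₀ hτ.2 hs) hτ
    (by linarith [hs.1]))

theorem nullKernel_nonneg (X : ℝ → ℝ) (hpos : ∀ t ∈ Ioo a b, 0 < X1 t) (hτ₀ : a < τ₀)
    (hτ : τ ∈ Ioo a b) {s : ℝ}
    (hs : s ∈ Ioc 0 (τ - τ₀)) : 0 ≤ nullKernel X X1 τ s := by
  have e1 := hpos τ hτ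
  have e2 := hpos _ (sub_mem_Ioo_of_mem_Ioc hτ₀ hτ.2 hs)
  unfold nullKernel
  positivity

theorem continuousOn_nullKernel (h1 : ∀ t ∈ Ioo a b, HasDerivAt X (X1 t) t)
    (hc : ContinuousOn X1 (Ioo a b)) (hpos : ∀ t ∈ Ioo a b, 0 < X1 t) (hτ₀ : a < τ₀)
    (hτ : τ ∈ Ioo a b) : ContinuousOn (nullKernel X X1 τ) (Ioc 0 (τ - τ₀)) := by
  have hmaps : MapsTo (fun s => τ - s) (Ioc 0 (τ - τ₀)) (Ioo a b) :=
    fun s hs => sub_mem_Ioo_of_mem_Ioc hτ₀ hτ.2 hs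
  have hsub : ContinuousOn (fun s => τ - s) (Ioc 0 (τ - τ₀)) := by fun_prop
  have hX : ContinuousOn X (Ioo a b) := fun t ht => (h1 t ht).continuousAt.continuousWithinAt
  unfold nullKernel
  refine (continuousOn_const.mul (hc.comp hsub hmaps)).div
    ((continuousOn_const.sub (hX.comp hsub hmaps)).pow 2) fun s hs => ?_
  exact pow_ne_zero 2 (sub_pos_of_mem_Ioc h1 hpos hτ₀ hτ hs).ne'

theorem hasDerivAt_inv_sub (h1 : ∀ t ∈ Ioo a b, HasDerivAt X (X1 t) t)
    (hpos : ∀ t ∈ Ioo a b, 0 < X1 t) (hτ₀ : a < τ₀) (hτ : τ ∈ Ioo a b) {s : ℝ}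
    (hs : s ∈ Ioc 0 (τ - τ₀)) :
    HasDerivAt (fun s => X1 τ / (X τ - X (τ - s))) (-nullKernel X X1 τ s) s := by
  have hsub : HasDerivAt (fun s : ℝ => τ - s) (-1) s := by
    simpa using (hasDerivAt_id s).const_sub τ
  have e1 := ((h1 _ (sub_mem_Ioo_of_mem_Ioc hτ₀ hτ.2 hs)).comp s hsub).const_sub (X τ)
  have e2 := (hasDerivAt_const s (X1 τ)).div e1 (sub_pos_of_mem_Ioc h1 hpos hτ₀ hτ hs).ne'
  refine e2.congr_deriv ?_
  unfold nullKernel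
  simp only [Function.comp_apply]
  ring

theorem integral_nullKernel (h1 : ∀ t ∈ Ioo a b, HasDerivAt X (X1 t) t)
    (hc : ContinuousOn X1 (Ioo a b)) (hpos : ∀ t ∈ Ioo a b, 0 < X1 t) (hτ₀ : a < τ₀)
    (hτ : τ ∈ Ioo a b) {s s' : ℝ} (hs : 0 < s) (hss : s ≤ s') (hs' : s' ≤ τ - τ₀) :
    IntervalIntegrable (nullKernel X X1 τ) volume s s' ∧
    ∫ y in s..s', nullKernel X X1 τ y =
      X1 τ / (X τ - X (τ - s)) - X1 τ / (X τ - X (τ - s')) := by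
  have hsub : uIcc s s' ⊆ Ioc 0 (τ - τ₀) := by
    rw [uIcc_of_le hss]
    exact fun y hy => ⟨hs.trans_le hy.1, hy.2.trans hs'⟩
  have hint : IntervalIntegrable (nullKernel X X1 τ) volume s s' :=
    ((continuousOn_nullKernel h1 hc hpos hτ₀ hτ).mono hsub).intervalIntegrable
  refine ⟨hint, ?_⟩
  have := intervalIntegral.integral_eq_sub_of_hasDerivAt
    (fun y hy => hasDerivAt_inv_sub h1 hpos hτ₀ hτ (hsub hy)) hint.neg
  rw [intervalIntegral.integral_neg] at this
  linarith

theorem intervalIntegrable_nullKernel_sub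
    (h1 : ∀ t ∈ Ioo a b, HasDerivAt X (X1 t) t) (hc : ContinuousOn X1 (Ioo a b))
    (hpos : ∀ t ∈ Ioo a b, 0 < X1 t) (hτ₀ : a < τ₀) (hτ : τ ∈ Ioo a b) (hττ : τ₀ < τ)
    (h2 : ∀ᶠ t in 𝓝 τ, HasDerivAt X1 (X2 t) t) (h3 : DifferentiableAt ℝ X2 τ) :
    IntervalIntegrable (fun s => nullKernel X X1 τ s - 1 / s ^ 2) volume 0 (τ - τ₀) := by
  obtain ⟨C, η, hη, hb⟩ := nullKernel_sub_bounded
    (eventually_of_mem (Ioo_mem_nhds hτ.1 hτ.2) h1) h2 h3 (hpos τ hτ)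
  refine intervalIntegrable_of_continuousOn_Ioc hη (by linarith)
    ((continuousOn_nullKernel h1 hc hpos hτ₀ hτ).sub ?_) hb
  exact continuousOn_const.div (by fun_prop) fun s hs => pow_ne_zero 2 hs.1.ne'

/-- Fundamental theorem of calculus for `1/s - X'(τ)/(X(τ) - X(τ-s))`, whose lower boundary value
exists only as a limit. -/
theorem integral_nullKernel_sub
    (h1 : ∀ t ∈ Ioo a b, HasDerivAt X (X1 t) t) (hc : ContinuousOn X1 (Ioo a b))
    (hpos : ∀ t ∈ Ioo a b, 0 < X1 t) (hτ₀ : a < τ₀) (hτ : τ ∈ Ioo a b) (hττ : τ₀ < τ)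
    (h2 : ∀ᶠ t in 𝓝 τ, HasDerivAt X1 (X2 t) t) (h3 : DifferentiableAt ℝ X2 τ) :
    ∫ s in (0 : ℝ)..(τ - τ₀), (nullKernel X X1 τ s - 1 / s ^ 2) =
      X2 τ / (2 * X1 τ) - X1 τ / (X τ - X τ₀) + 1 / (τ - τ₀) := by
  have hD : 0 < τ - τ₀ := by linarith
  have hder : ∀ s ∈ Ioc 0 (τ - τ₀),
      HasDerivAt (fun s => 1 / s - X1 τ / (X τ - X (τ - s)))
        (nullKernel X X1 τ s - 1 / s ^ 2) s := by
    intro s hs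
    have e1 : HasDerivAt (fun s : ℝ => 1 / s) (-(s ^ 2)⁻¹) s := by
      simpa using hasDerivAt_inv hs.1.ne'
    refine (e1.sub (hasDerivAt_inv_sub h1 hpos hτ₀ hτ hs)).congr_deriv ?_
    rw [one_div]; ring
  have h0 := tendsto_inv_sub_left (eventually_of_mem (Ioo_mem_nhds hτ.1 hτ.2) h1) h2 h3
    (hpos τ hτ)
  have hend : Tendsto (fun s => 1 / s - X1 τ / (X τ - X (τ - s))) (𝓝[<] (τ - τ₀))
      (𝓝 (1 / (τ - τ₀) - X1 τ / (X τ - X (τ - (τ - τ₀))))) :=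
    (hder _ ⟨hD, le_rfl⟩).continuousAt.tendsto.mono_left nhdsWithin_le_nhds
  have := intervalIntegral.integral_eq_sub_of_hasDerivAt_of_tendsto hD
    (fun s hs => hder s ⟨hs.1, hs.2.le⟩)
    (intervalIntegrable_nullKernel_sub h1 hc hpos hτ₀ hτ hττ h2 h3) h0 hend
  rw [this, sub_sub_cancel]
  ring

theorem intervalIntegrable_one_sub_cos_mul_nullKernel
    (h1 : ∀ t ∈ Ioo a b, HasDerivAt X (X1 t) t) (hc : ContinuousOn X1 (Ioo a b))
    (hpos : ∀ t ∈ Ioo a b, 0 < X1 t) (hτ₀ : a < τ₀) (hτ : τ ∈ Ioo a b) (hττ : τ₀ < τ)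
    (h2 : ∀ᶠ t in 𝓝 τ, HasDerivAt X1 (X2 t) t) (h3 : DifferentiableAt ℝ X2 τ) (E : ℝ) :
    IntervalIntegrable (fun s => (1 - Real.cos (E * s)) * nullKernel X X1 τ s) volume
      0 (τ - τ₀) := by
  have hD : 0 < τ - τ₀ := by linarith
  -- The factor `1 - cos` is bounded against `k_X - 1/s²` and is `O(s²)` against `1/s²`.
  have e1 := (intervalIntegrable_nullKernel_sub h1 hc hpos hτ₀ hτ hττ h2 h3).continuousOn_mul
    (g := fun s => 1 - Real.cos (E * s)) (by fun_prop)
  have e2 : IntervalIntegrable (fun s => (1 - Real.cos (E * s)) * (1 / s ^ 2)) volume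
      0 (τ - τ₀) := by
    refine intervalIntegrable_of_continuousOn_Ioc (C := E ^ 2 / 2) zero_lt_one hD.le ?_ ?_
    · refine ContinuousOn.mul (by fun_prop) ?_
      exact continuousOn_const.div (by fun_prop) fun s hs => pow_ne_zero 2 hs.1.ne'
    · intro s hs
      have hs0 := hs.1
      have hcos : 0 ≤ 1 - Real.cos (E * s) := by linarith [Real.cos_le_one (E * s)]
      rw [abs_of_nonneg (by positivity), mul_one_div, div_le_iff₀ (by positivity)]
      exact one_sub_cos_mul_le E s
  refine (e1.add e2).congr fun s _ => ?_
  ring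

/-- Three ranges: on `(0, h]` use `1 - cos(Es) ≤ E²s²/2` with the bound on `s² k_X`; on `[h, s₁]`
use `E²s₁²/2` times the exact integral of `k_X`; beyond `s₁` use `1 - cos ≤ 2`. The application has
`h = b - τ` and `s₁` small but nearly independent of `τ`. -/
theorem integral_one_sub_cos_mul_nullKernel_le
    (h1 : ∀ t ∈ Ioo a b, HasDerivAt X (X1 t) t) (hc : ContinuousOn X1 (Ioo a b))
    (hpos : ∀ t ∈ Ioo a b, 0 < X1 t) (hτ₀ : a < τ₀) (hτ : τ ∈ Ioo a b) (hττ : τ₀ < τ)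
    (h2 : ∀ᶠ t in 𝓝 τ, HasDerivAt X1 (X2 t) t) (h3 : DifferentiableAt ℝ X2 τ) (E : ℝ)
    {C h s₁ : ℝ} (hh : 0 < h) (hs₁ : h ≤ s₁) (hs₁' : s₁ ≤ τ - τ₀)
    (hC : ∀ s ∈ Ioc 0 h, s ^ 2 * nullKernel X X1 τ s ≤ C) :
    ∫ s in (0 : ℝ)..(τ - τ₀), (1 - Real.cos (E * s)) * nullKernel X X1 τ s ≤
      E ^ 2 / 2 * C * h + E ^ 2 / 2 * s₁ ^ 2 * (X1 τ / (X τ - X (τ - h))) +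
        2 * (X1 τ / (X τ - X (τ - s₁)) - X1 τ / (X τ - X τ₀)) := by
  have hint := intervalIntegrable_one_sub_cos_mul_nullKernel h1 hc hpos hτ₀ hτ hττ h2 h3 E
  have hs₁0 : 0 < s₁ := hh.trans_le hs₁
  have hD : 0 ≤ τ - τ₀ := by linarith
  have hmem : ∀ s, 0 ≤ s → s ≤ τ - τ₀ → s ∈ uIcc 0 (τ - τ₀) := fun s a b => by
    rw [uIcc_of_le hD]; exact ⟨a, b⟩
  have i1 := hint.mono_set (uIcc_subset_uIcc (hmem 0 le_rfl hD)
    (hmem h hh.le (hs₁.trans hs₁')))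
  have i2 := hint.mono_set (uIcc_subset_uIcc (hmem h hh.le (hs₁.trans hs₁'))
    (hmem s₁ hs₁0.le hs₁'))
  have i3 := hint.mono_set (uIcc_subset_uIcc (hmem s₁ hs₁0.le hs₁') (hmem _ hD le_rfl))
  rw [← intervalIntegral.integral_add_adjacent_intervals (i1.trans i2) i3,
    ← intervalIntegral.integral_add_adjacent_intervals i1 i2]
  obtain ⟨k2, v2⟩ := integral_nullKernel h1 hc hpos hτ₀ hτ hh hs₁ hs₁'
  obtain ⟨k3, v3⟩ := integral_nullKernel h1 hc hpos hτ₀ hτ hs₁0 hs₁' le_rfl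
  have hk : ∀ s ∈ Ioc 0 (τ - τ₀), 0 ≤ nullKernel X X1 τ s :=
    fun s hs => nullKernel_nonneg X hpos hτ₀ hτ hs
  have b1 : ∫ s in (0 : ℝ)..h, (1 - Real.cos (E * s)) * nullKernel X X1 τ s ≤
      E ^ 2 / 2 * C * h := by
    have := intervalIntegral.integral_mono_on_of_le_Ioo hh.le i1
      (intervalIntegrable_const (c := E ^ 2 / 2 * C)) (fun s hs => by
        have hs' : s ∈ Ioc 0 (τ - τ₀) := ⟨hs.1, hs.2.le.trans (hs₁.trans hs₁')⟩
        calc _ ≤ (E ^ 2 / 2 * s ^ 2) * nullKernel X X1 τ s :=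
              mul_le_mul_of_nonneg_right (one_sub_cos_mul_le E s) (hk s hs')
          _ = E ^ 2 / 2 * (s ^ 2 * nullKernel X X1 τ s) := by ring
          _ ≤ _ := mul_le_mul_of_nonneg_left (hC s ⟨hs.1, hs.2.le⟩) (by positivity))
    rw [intervalIntegral.integral_const, smul_eq_mul] at this
    linarith
  have b2 : ∫ s in h..s₁, (1 - Real.cos (E * s)) * nullKernel X X1 τ s ≤
      E ^ 2 / 2 * s₁ ^ 2 * (X1 τ / (X τ - X (τ - h))) := by
    have := intervalIntegral.integral_mono_on hs₁ i2 (k2.const_mul (E ^ 2 / 2 * s₁ ^ 2))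
      (fun s hs => by
        have hs' : s ∈ Ioc 0 (τ - τ₀) := ⟨hh.trans_le hs.1, hs.2.trans hs₁'⟩
        refine mul_le_mul_of_nonneg_right ((one_sub_cos_mul_le E s).trans ?_) (hk s hs')
        have := pow_le_pow_left₀ hs'.1.le hs.2 2
        gcongr)
    rw [intervalIntegral.integral_const_mul, v2] at this
    have hB : 0 ≤ X1 τ / (X τ - X (τ - s₁)) := div_nonneg (hpos τ hτ).le
      (sub_pos_of_mem_Ioc h1 hpos hτ₀ hτ ⟨hs₁0, hs₁'⟩).le
    refine this.trans (mul_le_mul_of_nonneg_left (by linarith) (by positivity))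
  have b3 : ∫ s in s₁..(τ - τ₀), (1 - Real.cos (E * s)) * nullKernel X X1 τ s ≤
      2 * (X1 τ / (X τ - X (τ - s₁)) - X1 τ / (X τ - X τ₀)) := by
    have := intervalIntegral.integral_mono_on hs₁' i3 (k3.const_mul 2)
      (fun s hs => by
        have hs' : s ∈ Ioc 0 (τ - τ₀) := ⟨hs₁0.trans_le hs.1, hs.2⟩
        exact mul_le_mul_of_nonneg_right (by linarith [Real.neg_one_le_cos (E * s)]) (hk s hs'))
    rwa [intervalIntegral.integral_const_mul, v3, sub_sub_cancel] at this
  linarith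

theorem integral_one_sub_cos_mul_nullKernel_nonneg
    (X : ℝ → ℝ) (hpos : ∀ t ∈ Ioo a b, 0 < X1 t) (hτ₀ : a < τ₀) (hτ : τ ∈ Ioo a b)
    (hττ : τ₀ < τ) (E : ℝ) :
    0 ≤ ∫ s in (0 : ℝ)..(τ - τ₀), (1 - Real.cos (E * s)) * nullKernel X X1 τ s := by
  rw [intervalIntegral.integral_of_le (by linarith)]
  refine setIntegral_nonneg measurableSet_Ioc fun s hs => ?_
  exact mul_nonneg (by linarith [Real.cos_le_one (E * s)]) (nullKernel_nonneg X hpos hτ₀ hτ hs)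

end Kernel

/-! ### Limit of one coordinate's contribution as the end point is approached. -/

section Asymptotics

variable {X X1 X2 : ℝ → ℝ} {a b c : ℝ}

/-- If `|X''/X'| ≤ K / (b - t)`, then `X'` varies at most by the factor `exp K` on `[τ - h, τ]`,
where `h = b - τ`. -/
theorem abs_log_sub_log_le {K τ : ℝ} (hpos : ∀ t ∈ Ioo c b, 0 < X1 t)
    (h2 : ∀ t ∈ Ioo c b, HasDerivAt X1 (X2 t) t)
    (hK : ∀ t ∈ Ioo c b, |(b - t) * (X2 t / X1 t)| ≤ K) (hτ : τ < b) (hc : c < τ - (b - τ))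
    {t : ℝ} (ht : t ∈ Icc (τ - (b - τ)) τ) : |Real.log (X1 t) - Real.log (X1 τ)| ≤ K := by
  have hh : 0 < b - τ := by linarith
  have hsub : ∀ y ∈ Icc (τ - (b - τ)) τ, y ∈ Ioo c b := fun y hy =>
    ⟨hc.trans_le hy.1, hy.2.trans_lt hτ⟩
  have key := Convex.norm_image_sub_le_of_norm_hasDerivWithin_le (𝕜 := ℝ)
    (f := fun y => Real.log (X1 y)) (f' := fun y => X2 y / X1 y) (C := K / (b - τ))
    (s := Icc (τ - (b - τ)) τ) (x := τ) (y := t)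
    (fun y hy => ((h2 y (hsub y hy)).log (hpos y (hsub y hy)).ne').hasDerivWithinAt)
    (fun y hy => by
      have h1 := hK y (hsub y hy)
      rw [abs_mul, abs_of_pos (show 0 < b - y by linarith [hy.2])] at h1
      rw [Real.norm_eq_abs, le_div_iff₀ hh]
      refine le_trans ?_ h1
      rw [mul_comm]
      exact mul_le_mul_of_nonneg_right (by linarith [hy.2]) (abs_nonneg _))
    (convex_Icc _ _) ⟨by linarith, le_rfl⟩ ht
  rw [Real.norm_eq_abs, Real.norm_eq_abs] at key
  have hK0 : 0 ≤ K := (abs_nonneg _).trans (hK τ (hsub τ ⟨by linarith, le_rfl⟩))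
  refine key.trans ?_
  rw [div_mul_eq_mul_div, div_le_iff₀ hh]
  refine mul_le_mul_of_nonneg_left ?_ hK0
  rw [abs_le]
  constructor <;> linarith [ht.1, ht.2]

theorem mul_exp_neg_le_and_le_mul_exp {K τ : ℝ} (hpos : ∀ t ∈ Ioo c b, 0 < X1 t)
    (h2 : ∀ t ∈ Ioo c b, HasDerivAt X1 (X2 t) t)
    (hK : ∀ t ∈ Ioo c b, |(b - t) * (X2 t / X1 t)| ≤ K) (hτ : τ < b) (hc : c < τ - (b - τ))
    {t : ℝ} (ht : t ∈ Icc (τ - (b - τ)) τ) :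
    X1 τ * Real.exp (-K) ≤ X1 t ∧ X1 t ≤ X1 τ * Real.exp K := by
  have h := abs_le.1 (abs_log_sub_log_le hpos h2 hK hτ hc ht)
  have ht' := hpos t ⟨hc.trans_le ht.1, ht.2.trans_lt hτ⟩
  have hτ' := hpos τ ⟨by linarith, hτ⟩
  constructor
  · calc X1 τ * Real.exp (-K) = Real.exp (Real.log (X1 τ) + -K) := by
          rw [Real.exp_add, Real.exp_log hτ']
      _ ≤ Real.exp (Real.log (X1 t)) := Real.exp_le_exp.2 (by linarith [h.1])
      _ = X1 t := Real.exp_log ht'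
  · calc X1 t = Real.exp (Real.log (X1 t)) := (Real.exp_log ht').symm
      _ ≤ Real.exp (Real.log (X1 τ) + K) := Real.exp_le_exp.2 (by linarith [h.2])
      _ = X1 τ * Real.exp K := by rw [Real.exp_add, Real.exp_log hτ']

/-- Mean value theorem: `X'` is comparable to `X'(τ)` on the scale `b - τ`. -/
theorem mul_exp_neg_mul_le_sub {K τ : ℝ} (h1 : ∀ t ∈ Ioo c b, HasDerivAt X (X1 t) t)
    (hpos : ∀ t ∈ Ioo c b, 0 < X1 t) (h2 : ∀ t ∈ Ioo c b, HasDerivAt X1 (X2 t) t)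
    (hK : ∀ t ∈ Ioo c b, |(b - t) * (X2 t / X1 t)| ≤ K) (hτ : τ < b) (hc : c < τ - (b - τ))
    {s : ℝ} (hs : s ∈ Ioc 0 (b - τ)) : X1 τ * Real.exp (-K) * s ≤ X τ - X (τ - s) := by
  have hsub : ∀ y ∈ Icc (τ - s) τ, y ∈ Ioo c b := fun y hy =>
    ⟨by linarith [hy.1, hs.2], hy.2.trans_lt hτ⟩
  obtain ⟨y, hy, e⟩ := exists_hasDerivAt_eq_slope X X1 (show τ - s < τ by linarith [hs.1])
    (fun y hy => (h1 y (hsub y hy)).continuousAt.continuousWithinAt)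
    (fun y hy => h1 y (hsub y ⟨hy.1.le, hy.2.le⟩))
  have := (mul_exp_neg_le_and_le_mul_exp hpos h2 hK hτ hc
    (t := y) ⟨by linarith [hy.1, hs.2], hy.2.le⟩).1
  rwa [e, sub_sub_cancel, le_div_iff₀ hs.1] at this

/-- On the scale `s ≤ b - τ` the kernel is comparable to `1/s²` with a constant independent of `τ`,
even where `X'` blows up. -/
theorem sq_mul_nullKernel_le {K τ : ℝ} (h1 : ∀ t ∈ Ioo c b, HasDerivAt X (X1 t) t)
    (hpos : ∀ t ∈ Ioo c b, 0 < X1 t) (h2 : ∀ t ∈ Ioo c b, HasDerivAt X1 (X2 t) t)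
    (hK : ∀ t ∈ Ioo c b, |(b - t) * (X2 t / X1 t)| ≤ K) (hτ : τ < b) (hc : c < τ - (b - τ))
    {s : ℝ} (hs : s ∈ Ioc 0 (b - τ)) :
    s ^ 2 * nullKernel X X1 τ s ≤ Real.exp K / Real.exp (-K) ^ 2 := by
  have hs0 := hs.1
  have hτ' : 0 < X1 τ := hpos τ ⟨by linarith, hτ⟩
  have hlow := mul_exp_neg_mul_le_sub h1 hpos h2 hK hτ hc hs
  have hup := (mul_exp_neg_le_and_le_mul_exp hpos h2 hK hτ hc
    (t := τ - s) ⟨by linarith [hs.2], by linarith⟩).2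
  have hl0 : 0 < X1 τ * Real.exp (-K) * s := by positivity
  have hw : 0 < X τ - X (τ - s) := hl0.trans_le hlow
  unfold nullKernel
  rw [mul_div_assoc', div_le_div_iff₀ (by positivity) (by positivity)]
  calc s ^ 2 * (X1 τ * X1 (τ - s)) * Real.exp (-K) ^ 2
      ≤ s ^ 2 * (X1 τ * (X1 τ * Real.exp K)) * Real.exp (-K) ^ 2 := by gcongr
    _ = Real.exp K * (X1 τ * Real.exp (-K) * s) ^ 2 := by ring
    _ ≤ _ := by gcongr

theorem tendsto_sub_nhdsLT (b : ℝ) : Tendsto (fun τ => b - τ) (𝓝[<] b) (𝓝 0) := by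
  have : Tendsto (fun τ : ℝ => b - τ) (𝓝 b) (𝓝 (b - b)) :=
    (continuous_const.sub continuous_id).tendsto b
  rw [sub_self] at this
  exact this.mono_left nhdsWithin_le_nhds

/-- Contribution of one null coordinate to the transition rate. -/
theorem tendsto_integral_cos_mul_nullKernel {τ₀ α β : ℝ} (E : ℝ) (hτ₀ : τ₀ ∈ Ioo a b)
    (h1 : ∀ t ∈ Ioo a b, HasDerivAt X (X1 t) t) (hc : ContinuousOn X1 (Ioo a b))
    (hpos : ∀ t ∈ Ioo a b, 0 < X1 t)
    (h2 : ∀ᶠ t in 𝓝[<] b, HasDerivAt X1 (X2 t) t) (h3 : ∀ᶠ t in 𝓝[<] b, DifferentiableAt ℝ X2 t)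
    (hα : ∀ t ∈ Ioo a b, Tendsto (fun τ => (b - τ) * (X1 τ / (X τ - X t))) (𝓝[<] b) (𝓝 α))
    (hβ : Tendsto (fun τ => (b - τ) * (X2 τ / X1 τ)) (𝓝[<] b) (𝓝 β)) :
    (∀ᶠ τ in 𝓝[<] b, IntervalIntegrable
      (fun s => Real.cos (E * s) * nullKernel X X1 τ s - 1 / s ^ 2) volume 0 (τ - τ₀)) ∧
    Tendsto (fun τ => (b - τ) *
      ∫ s in (0 : ℝ)..(τ - τ₀), (Real.cos (E * s) * nullKernel X X1 τ s - 1 / s ^ 2))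
      (𝓝[<] b) (𝓝 (β / 2 - α)) := by
  -- Any number above `|β|` eventually bounds `|(b - t) X''/X'|`.
  set K := |β| + 1 with hKdef
  have hKev : ∀ᶠ t in 𝓝[<] b, |(b - t) * (X2 t / X1 t)| ≤ K :=
    (hβ.abs.eventually (gt_mem_nhds (show |β| < |β| + 1 by linarith))).mono fun _ h => h.le
  obtain ⟨c, hcb, hcK⟩ := (mem_nhdsLT_iff_exists_Ioo_subset' hτ₀.2).1
    (h2.and (h3.and (hKev.and (Ioo_mem_nhdsLT hτ₀.2))))
  have hcsub : ∀ t ∈ Ioo c b, t ∈ Ioo a b := fun t ht =>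
    ⟨hτ₀.1.trans (hcK ht).2.2.2.1, ht.2⟩
  have hloc : ∀ τ ∈ Ioo c b, (∀ᶠ t in 𝓝 τ, HasDerivAt X1 (X2 t) t) := fun τ hτ =>
    eventually_of_mem (Ioo_mem_nhds hτ.1 hτ.2) fun t ht => (hcK ht).1
  have hev : ∀ᶠ τ in 𝓝[<] b, τ ∈ Ioo c b := Ioo_mem_nhdsLT hcb
  have hsplit : ∀ τ ∈ Ioo c b, IntervalIntegrable
      (fun s => Real.cos (E * s) * nullKernel X X1 τ s - 1 / s ^ 2) volume 0 (τ - τ₀) ∧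
      ∫ s in (0 : ℝ)..(τ - τ₀), (Real.cos (E * s) * nullKernel X X1 τ s - 1 / s ^ 2) =
        (X2 τ / (2 * X1 τ) - X1 τ / (X τ - X τ₀) + 1 / (τ - τ₀)) -
        ∫ s in (0 : ℝ)..(τ - τ₀), (1 - Real.cos (E * s)) * nullKernel X X1 τ s := by
    intro τ hτ
    have hlt : τ₀ < τ := (hcK hτ).2.2.2.1
    have e1 := intervalIntegrable_nullKernel_sub h1 hc hpos hτ₀.1 (hcsub τ hτ) hlt (hloc τ hτ)
      (hcK hτ).2.1
    have e2 := intervalIntegrable_one_sub_cos_mul_nullKernel h1 hc hpos hτ₀.1 (hcsub τ hτ) hlt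
      (hloc τ hτ) (hcK hτ).2.1 E
    have e : (fun s => Real.cos (E * s) * nullKernel X X1 τ s - 1 / s ^ 2) =
        fun s => (nullKernel X X1 τ s - 1 / s ^ 2) -
          (1 - Real.cos (E * s)) * nullKernel X X1 τ s := by
      funext s; ring
    rw [e, intervalIntegral.integral_sub e1 e2, integral_nullKernel_sub h1 hc hpos hτ₀.1
      (hcsub τ hτ) hlt (hloc τ hτ) (hcK hτ).2.1]
    exact ⟨e1.sub e2, rfl⟩
  refine ⟨hev.mono fun τ hτ => (hsplit τ hτ).1, ?_⟩
  have hcorr : Tendsto (fun τ => (b - τ) *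
      ∫ s in (0 : ℝ)..(τ - τ₀), (1 - Real.cos (E * s)) * nullKernel X X1 τ s) (𝓝[<] b) (𝓝 0) := by
    rw [Metric.tendsto_nhds]
    intro e he
    have hτ₁ : Tendsto (fun t => E ^ 2 / 2 * (b - t) ^ 2 * Real.exp K) (𝓝[<] b) (𝓝 0) := by
      have := (((tendsto_sub_nhdsLT b).pow 2).const_mul (E ^ 2 / 2)).mul_const (Real.exp K)
      simpa using this
    -- After multiplication by `b - τ`, the near range is `O((b - τ)²)`, and the far range is a
    -- difference of two quantities with the same limit `α`. Only the middle range survives, and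
    -- `τ₁` close to `b` puts it below `e`.
    obtain ⟨τ₁, hsmall, hτ₁c⟩ := ((hτ₁.eventually (gt_mem_nhds he)).and hev).exists
    have hτ₁' := hcsub τ₁ hτ₁c
    have hlim : Tendsto (fun τ => E ^ 2 / 2 * (Real.exp K / Real.exp (-K) ^ 2) * (b - τ) ^ 2 +
        E ^ 2 / 2 * (b - τ₁) ^ 2 * Real.exp K +
        2 * ((b - τ) * (X1 τ / (X τ - X τ₁)) - (b - τ) * (X1 τ / (X τ - X τ₀)))) (𝓝[<] b)
        (𝓝 (E ^ 2 / 2 * (b - τ₁) ^ 2 * Real.exp K)) := by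
      have := ((((tendsto_sub_nhdsLT b).pow 2).const_mul
        (E ^ 2 / 2 * (Real.exp K / Real.exp (-K) ^ 2))).add_const
        (E ^ 2 / 2 * (b - τ₁) ^ 2 * Real.exp K)).add
        (((hα τ₁ hτ₁').sub (hα τ₀ hτ₀)).const_mul 2)
      simpa using this
    -- This gives both `b - τ ≤ τ - τ₁` and `τ₁ < τ - (b - τ)`, so the window of length `b - τ` to
    -- the left of `τ` stays in the controlled interval.
    have hnear : ∀ᶠ τ in 𝓝[<] b, b - τ < (b - τ₁) / 2 :=
      (tendsto_sub_nhdsLT b).eventually (gt_mem_nhds (by linarith [hτ₁c.2]))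
    filter_upwards [hev, hlim.eventually (gt_mem_nhds hsmall), hnear] with τ hτ hlt hn
    have hlt₀ : τ₀ < τ := (hcK hτ).2.2.2.1
    have hh : 0 < b - τ := by linarith [hτ.2]
    have hnn := integral_one_sub_cos_mul_nullKernel_nonneg X hpos hτ₀.1 (hcsub τ hτ) hlt₀ E
    have hcc : c < τ - (b - τ) := by linarith [hτ₁c.1]
    have g1 : ∀ t ∈ Ioo c b, HasDerivAt X (X1 t) t := fun t ht => h1 t (hcsub t ht)
    have gp : ∀ t ∈ Ioo c b, 0 < X1 t := fun t ht => hpos t (hcsub t ht)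
    have g2 : ∀ t ∈ Ioo c b, HasDerivAt X1 (X2 t) t := fun t ht => (hcK ht).1
    have gK : ∀ t ∈ Ioo c b, |(b - t) * (X2 t / X1 t)| ≤ K := fun t ht => (hcK ht).2.2.1
    have hτ₁₀ : τ₀ < τ₁ := (hcK hτ₁c).2.2.2.1
    have hle := integral_one_sub_cos_mul_nullKernel_le h1 hc hpos hτ₀.1 (hcsub τ hτ) hlt₀
      (hloc τ hτ) (hcK hτ).2.1 E (C := Real.exp K / Real.exp (-K) ^ 2) (h := b - τ)
      (s₁ := τ - τ₁) hh (by linarith) (by linarith)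
      (fun s hs => sq_mul_nullKernel_le g1 gp g2 gK hτ.2 hcc hs)
    rw [sub_sub_cancel] at hle
    have hB : (b - τ) * (X1 τ / (X τ - X (τ - (b - τ)))) ≤ Real.exp K := by
      have hlow := mul_exp_neg_mul_le_sub g1 gp g2 gK hτ.2 hcc ⟨hh, le_rfl⟩
      have hX1 := gp τ hτ
      have hl0 : 0 < X1 τ * Real.exp (-K) * (b - τ) := by positivity
      rw [mul_div_assoc', div_le_iff₀ (hl0.trans_le hlow)]
      calc (b - τ) * X1 τ = Real.exp K * (X1 τ * Real.exp (-K) * (b - τ)) := by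
            rw [Real.exp_neg]; field_simp
        _ ≤ _ := by gcongr
    rw [Real.dist_eq, sub_zero, abs_of_nonneg (mul_nonneg hh.le hnn)]
    refine lt_of_le_of_lt ((mul_le_mul_of_nonneg_left hle hh.le).trans ?_) hlt
    have hsq : (τ - τ₁) ^ 2 ≤ (b - τ₁) ^ 2 :=
      pow_le_pow_left₀ (by linarith) (by linarith [hτ.2]) 2
    have hmid : E ^ 2 / 2 * (τ - τ₁) ^ 2 * ((b - τ) * (X1 τ / (X τ - X (τ - (b - τ))))) ≤
        E ^ 2 / 2 * (b - τ₁) ^ 2 * Real.exp K :=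
      (mul_le_mul_of_nonneg_left hB (by positivity)).trans (by gcongr)
    linear_combination hmid
  have hmain : Tendsto (fun τ => (b - τ) * (X2 τ / X1 τ) / 2 - (b - τ) * (X1 τ / (X τ - X τ₀)) +
      (b - τ) * (1 / (τ - τ₀)) - (b - τ) *
      ∫ s in (0 : ℝ)..(τ - τ₀), (1 - Real.cos (E * s)) * nullKernel X X1 τ s) (𝓝[<] b)
      (𝓝 (β / 2 - α + 0 * (1 / (b - τ₀)) - 0)) := by
    refine (((hβ.div_const 2).sub (hα τ₀ hτ₀)).add ((tendsto_sub_nhdsLT b).mul ?_)).sub hcorr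
    have : ContinuousAt (fun τ => 1 / (τ - τ₀)) b :=
      continuousAt_const.div (by fun_prop) (by linarith [hτ₀.2])
    exact this.tendsto.mono_left nhdsWithin_le_nhds
  rw [zero_mul, add_zero, sub_zero] at hmain
  refine hmain.congr' (hev.mono fun τ hτ => ?_)
  simp only [(hsplit τ hτ).2]
  ring

end Asymptotics

/-! ### The Kruskal product as a `C¹` function across the event horizon. -/

namespace GenRN

variable (S : GenRN)

theorem hasDerivAt_F {r : ℝ} (hr : 0 < r) : HasDerivAt S.F (deriv S.F r) r :=
  ((S.smooth.contDiffAt (Ioi_mem_nhds hr)).differentiableAt (by simp)).hasDerivAt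

theorem differentiableAt_deriv_F {r : ℝ} (hr : 0 < r) : DifferentiableAt ℝ (deriv S.F) r := by
  have h : ContDiffOn ℝ 1 (deriv S.F) (Ioi 0) :=
    (contDiffOn_infty_iff_deriv_of_isOpen isOpen_Ioi).1 S.smooth |>.2.of_le (by simp)
  exact (h.contDiffAt (Ioi_mem_nhds hr)).differentiableAt (by simp)

theorem rp_pos : 0 < S.rp := S.rm_pos.trans S.rm_lt_rp

theorem kappaP_pos : 0 < S.kappaP := half_pos S.deriv_rp_pos

theorem kappaM_neg : S.kappaM < 0 := by
  have := S.deriv_rm_neg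
  unfold kappaM
  linarith

theorem F_rp : S.F S.rp = 0 := by
  have hc := (S.hasDerivAt_F S.rp_pos).continuousAt.tendsto
  refine le_antisymm ?_ ?_
  · refine le_of_tendsto (hc.mono_left (nhdsWithin_le_nhds (s := Iio S.rp))) ?_
    filter_upwards [Ioo_mem_nhdsLT S.rm_lt_rp] with r hr
    exact (S.neg_between r hr.1 hr.2).le
  · refine ge_of_tendsto (hc.mono_left (nhdsWithin_le_nhds (s := Ioi S.rp))) ?_
    filter_upwards [self_mem_nhdsWithin] with r hr
    exact (S.pos_exterior r hr).le

theorem F_rm : S.F S.rm = 0 := by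
  have hc := (S.hasDerivAt_F S.rm_pos).continuousAt.tendsto
  refine le_antisymm ?_ ?_
  · refine le_of_tendsto (hc.mono_left (nhdsWithin_le_nhds (s := Ioi S.rm))) ?_
    filter_upwards [Ioo_mem_nhdsGT S.rm_lt_rp] with r hr
    exact (S.neg_between r hr.1 hr.2).le
  · refine ge_of_tendsto (hc.mono_left (nhdsWithin_le_nhds (s := Iio S.rm))) ?_
    filter_upwards [Ioo_mem_nhdsLT S.rm_pos] with r hr
    exact (S.pos_inner r hr.1 hr.2).le

theorem F_ne_zero {r : ℝ} (hr : S.rm < r) (hr' : r ≠ S.rp) : S.F r ≠ 0 := by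
  rcases lt_or_gt_of_ne hr' with h | h
  · exact (S.neg_between r hr h).ne
  · exact (S.pos_exterior r h).ne'

/-- The integrand in the exponent of `kruskalProduct`. -/
noncomputable def kruskalIntegrand (y : ℝ) : ℝ := 2 * S.kappaP / S.F y - 1 / (y - S.rp)

/-- The exponent of `kruskalProduct`. -/
noncomputable def kruskalExponent (r : ℝ) : ℝ := ∫ y in S.rp..r, S.kruskalIntegrand y

/-- The derivative of `kruskalProduct`. -/
noncomputable def kruskalProductDeriv (r : ℝ) : ℝ :=
  Real.exp (S.kruskalExponent r) * ((S.rp - r) * S.kruskalIntegrand r - 1)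

theorem kruskalProduct_eq (r : ℝ) :
    S.kruskalProduct r = (S.rp - r) * Real.exp (S.kruskalExponent r) := rfl

/-- The two simple poles at `r₊` have equal residue, because `F'(r₊) = 2κ₊`. Boundedness replaces
removing the singularity: it suffices for integrability and for continuity of the exponent. -/
theorem kruskalIntegrand_bounded :
    ∃ C η : ℝ, 0 < η ∧ ∀ y, |y - S.rp| ≤ η → |S.kruskalIntegrand y| ≤ C := by
  have hκ := S.kappaP_pos
  obtain ⟨M, hM, hO⟩ := (S.differentiableAt_deriv_F S.rp_pos).hasDerivAt.isBigO_sub.exists_pos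
  rw [Asymptotics.isBigOWith_iff] at hO
  obtain ⟨η, hη, hball⟩ := Metric.eventually_nhds_iff.1 (hO.and (lt_mem_nhds S.rp_pos))
  -- The radius `κ₊/M` makes the quadratic remainder at most `κ₊|y - r₊|`, whence `|F y| ≥ κ₊|y -
  -- r₊|`.
  refine ⟨M / S.kappaP, min (η / 2) (S.kappaP / M), by positivity, fun y hy => ?_⟩
  rcases eq_or_ne y S.rp with rfl | hne
  -- At `y = r₊` both fractions are divisions by zero, so the integrand has the value `0`.
  · simp [kruskalIntegrand, F_rp]
    positivity
  have hd0 : 0 < |y - S.rp| := abs_pos.2 (sub_ne_zero.2 hne)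
  have hy1 : |y - S.rp| < η := by linarith [hy.trans (min_le_left _ _)]
  have hy2 : M * |y - S.rp| ≤ S.kappaP := by
    have := hy.trans (min_le_right _ _)
    rw [le_div_iff₀ hM] at this
    linarith
  have hseg : ∀ t ∈ uIcc S.rp y, |t - S.rp| ≤ |y - S.rp| := fun t ht =>
    abs_sub_left_of_mem_uIcc ht
  have hlin : |S.F y - 2 * S.kappaP * (y - S.rp)| ≤ M * |y - S.rp| * |y - S.rp| := by
    have key := Convex.norm_image_sub_le_of_norm_hasDerivWithin_le (𝕜 := ℝ)
      (f := fun t => S.F t - deriv S.F S.rp * t) (f' := fun t => deriv S.F t - deriv S.F S.rp)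
      (C := M * |y - S.rp|) (s := uIcc S.rp y) (x := S.rp) (y := y)
      (fun t ht => by
        have h0 : 0 < t := (hball (y := t) ((hseg t ht).trans_lt hy1)).2
        refine HasDerivAt.hasDerivWithinAt ?_
        exact ((S.hasDerivAt_F h0).sub
          ((hasDerivAt_id t).const_mul (deriv S.F S.rp))).congr_deriv (by rw [mul_one]))
      (fun t ht => (hball (y := t) ((hseg t ht).trans_lt hy1)).1.trans
        (mul_le_mul_of_nonneg_left (hseg t ht) hM.le))
      (convex_uIcc _ _) left_mem_uIcc right_mem_uIcc
    have e : S.F y - deriv S.F S.rp * y - (S.F S.rp - deriv S.F S.rp * S.rp) =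
        S.F y - 2 * S.kappaP * (y - S.rp) := by
      rw [F_rp]; unfold kappaP; ring
    simp only [e, Real.norm_eq_abs] at key
    exact key
  have hlow : S.kappaP * |y - S.rp| ≤ |S.F y| := by
    have h1 : |2 * S.kappaP * (y - S.rp)| - |S.F y - 2 * S.kappaP * (y - S.rp)| ≤ |S.F y| := by
      have := abs_sub_abs_le_abs_sub (2 * S.kappaP * (y - S.rp))
        (-(S.F y - 2 * S.kappaP * (y - S.rp)))
      rw [abs_neg] at this
      refine this.trans_eq (by congr 1; ring)
    rw [abs_mul, abs_of_pos (show 0 < 2 * S.kappaP by positivity)] at h1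
    nlinarith [mul_le_mul_of_nonneg_right hy2 hd0.le]
  have hF : 0 < |S.F y| := lt_of_lt_of_le (by positivity) hlow
  have hF' : S.F y ≠ 0 := abs_pos.1 hF
  have hsub : y - S.rp ≠ 0 := sub_ne_zero.2 hne
  have e : S.kruskalIntegrand y =
      -(S.F y - 2 * S.kappaP * (y - S.rp)) / (S.F y * (y - S.rp)) := by
    unfold kruskalIntegrand
    field_simp
    ring
  rw [e, abs_div, abs_neg, abs_mul, div_le_div_iff₀ (by positivity) hκ]
  calc _ ≤ M * |y - S.rp| * |y - S.rp| * S.kappaP := by gcongr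
    _ = M * (S.kappaP * |y - S.rp| * |y - S.rp|) := by ring
    _ ≤ _ := by gcongr

theorem continuousAt_kruskalIntegrand {r : ℝ} (hr : S.rm < r) (hr' : r ≠ S.rp) :
    ContinuousAt S.kruskalIntegrand r :=
  (continuousAt_const.div (S.hasDerivAt_F (S.rm_pos.trans hr)).continuousAt
    (S.F_ne_zero hr hr')).sub
    (continuousAt_const.div (by fun_prop) (sub_ne_zero.2 hr'))

theorem intervalIntegrable_kruskalIntegrand {r : ℝ} (hr : S.rm < r) :
    IntervalIntegrable S.kruskalIntegrand volume S.rp r := by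
  obtain ⟨C, η, hη, hb⟩ := S.kruskalIntegrand_bounded
  rcases le_total S.rp r with h | h
  · have := (intervalIntegrable_of_continuousOn_Ioc (f := fun s => S.kruskalIntegrand (S.rp + s))
      (C := C) hη (sub_nonneg.2 h) (fun s hs => ?_) (fun s hs => hb _ ?_)).comp_sub_right S.rp
    · simpa using this
    · have := hs.1
      exact (ContinuousAt.comp (g := S.kruskalIntegrand) (S.continuousAt_kruskalIntegrand
        (by linarith [S.rm_lt_rp]) (by linarith)) (by fun_prop)).continuousWithinAt
    · rw [add_sub_cancel_left, abs_of_pos hs.1]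
      exact hs.2
  · have := (intervalIntegrable_of_continuousOn_Ioc (f := fun s => S.kruskalIntegrand (S.rp - s))
      (C := C) hη (sub_nonneg.2 h) (fun s hs => ?_) (fun s hs => hb _ ?_)).comp_sub_left S.rp
    · simpa using this
    · have h1 := hs.1
      have h2 := hs.2
      exact (ContinuousAt.comp (g := S.kruskalIntegrand) (S.continuousAt_kruskalIntegrand
        (by linarith) (by linarith)) (by fun_prop)).continuousWithinAt
    · rw [sub_sub_cancel_left, abs_neg, abs_of_pos hs.1]
      exact hs.2

theorem hasDerivAt_kruskalExponent {r : ℝ} (hr : S.rm < r) (hr' : r ≠ S.rp) :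
    HasDerivAt S.kruskalExponent (S.kruskalIntegrand r) r := by
  refine intervalIntegral.integral_hasDerivAt_right (S.intervalIntegrable_kruskalIntegrand hr) ?_
    (S.continuousAt_kruskalIntegrand hr hr')
  refine ContinuousOn.stronglyMeasurableAtFilter (s := Ioi S.rm ∩ {S.rp}ᶜ)
    (isOpen_Ioi.inter isOpen_compl_singleton) (fun y hy => ?_) r ⟨hr, hr'⟩
  exact (S.continuousAt_kruskalIntegrand hy.1 hy.2).continuousWithinAt

theorem continuousAt_kruskalExponent {r : ℝ} (hr : S.rm < r) :
    ContinuousAt S.kruskalExponent r := by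
  rcases eq_or_ne r S.rp with rfl | hne
  swap
  · exact (S.hasDerivAt_kruskalExponent hr hne).continuousAt
  obtain ⟨C, η, hη, hb⟩ := S.kruskalIntegrand_bounded
  have h0 : S.kruskalExponent S.rp = 0 := intervalIntegral.integral_same
  unfold ContinuousAt
  rw [h0]
  have hlim : Tendsto (fun r => C * |r - S.rp|) (𝓝 S.rp) (𝓝 0) := by
    have : Continuous fun r => C * |r - S.rp| := by fun_prop
    simpa using this.tendsto S.rp
  refine squeeze_zero_norm' ?_ hlim
  filter_upwards [Metric.closedBall_mem_nhds S.rp hη] with r hr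
  refine intervalIntegral.norm_integral_le_of_norm_le_const fun y hy => hb y ?_
  exact (abs_sub_left_of_mem_uIcc (uIoc_subset_uIcc hy)).trans hr

theorem kruskalProductDeriv_eq {r : ℝ} (hr : S.rm < r) (hr' : r ≠ S.rp) :
    S.kruskalProductDeriv r = 2 * S.kappaP * S.kruskalProduct r / S.F r := by
  have h1 := S.F_ne_zero hr hr'
  have h2 := sub_ne_zero.2 hr'
  rw [kruskalProduct_eq, kruskalProductDeriv, kruskalIntegrand]
  field_simp
  ring

theorem kruskalProductDeriv_rp : S.kruskalProductDeriv S.rp = -1 := by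
  simp [kruskalProductDeriv, kruskalExponent]

theorem kruskalProduct_rp : S.kruskalProduct S.rp = 0 := by
  simp [kruskalProduct_eq]

/-- The integrand carries the conventional value `0` at `r₊`, so the exponent is not differentiated
there; the factor `r₊ - r` makes the slope equal to `-exp` of the exponent, which is continuous. -/
theorem hasDerivAt_kruskalProduct {r : ℝ} (hr : S.rm < r) :
    HasDerivAt S.kruskalProduct (S.kruskalProductDeriv r) r := by
  rcases eq_or_ne r S.rp with rfl | hne
  · rw [kruskalProductDeriv_rp, hasDerivAt_iff_tendsto_slope]
    have h0 : S.kruskalExponent S.rp = 0 := intervalIntegral.integral_same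
    have hE := ((S.continuousAt_kruskalExponent hr).rexp.neg).tendsto
    simp only [Pi.neg_apply, h0, Real.exp_zero] at hE
    refine (hE.mono_left nhdsWithin_le_nhds).congr' ?_
    filter_upwards [self_mem_nhdsWithin] with r hr
    have : r - S.rp ≠ 0 := sub_ne_zero.2 hr
    rw [slope_def_field, kruskalProduct_rp, kruskalProduct_eq, Pi.neg_apply]
    field_simp
    ring
  · have e1 := ((hasDerivAt_id r).const_sub S.rp).mul (S.hasDerivAt_kruskalExponent hr hne).exp
    refine e1.congr_deriv ?_
    simp only [kruskalProductDeriv, id_eq]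
    ring

theorem continuousAt_kruskalProductDeriv {r : ℝ} (hr : S.rm < r) :
    ContinuousAt S.kruskalProductDeriv r := by
  refine (S.continuousAt_kruskalExponent hr).rexp.mul (ContinuousAt.sub ?_ continuousAt_const)
  rcases eq_or_ne r S.rp with rfl | hne
  swap
  · exact (by fun_prop : ContinuousAt (fun r => S.rp - r) r).mul
      (S.continuousAt_kruskalIntegrand hr hne)
  obtain ⟨C, η, hη, hb⟩ := S.kruskalIntegrand_bounded
  unfold ContinuousAt
  simp only [sub_self, zero_mul]
  have hlim : Tendsto (fun r => |S.rp - r| * C) (𝓝 S.rp) (𝓝 0) := by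
    have : Continuous fun r => |S.rp - r| * C := by fun_prop
    simpa using this.tendsto S.rp
  refine squeeze_zero_norm' ?_ hlim
  filter_upwards [Metric.closedBall_mem_nhds S.rp hη] with r hr
  rw [norm_mul]
  exact mul_le_mul_of_nonneg_left (hb r hr) (abs_nonneg _)

theorem kruskalProduct_pos {r : ℝ} (hr : r < S.rp) : 0 < S.kruskalProduct r :=
  mul_pos (sub_pos.2 hr) (Real.exp_pos _)

theorem kruskalProduct_neg {r : ℝ} (hr : S.rp < r) : S.kruskalProduct r < 0 :=
  mul_neg_of_neg_of_pos (sub_neg.2 hr) (Real.exp_pos _)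

end GenRN

/-! ### Two criteria for growth at the end point. -/

/-- Gives `α = 0` for the coordinates that are regular at the Cauchy horizon. -/
theorem tendsto_mul_div_sub_of_bounded {X X1 : ℝ → ℝ} {a b C t : ℝ}
    (h1 : ∀ t ∈ Ioo a b, HasDerivAt X (X1 t) t) (hpos : ∀ t ∈ Ioo a b, 0 < X1 t)
    (hC : ∀ᶠ τ in 𝓝[<] b, X1 τ ≤ C) (ht : t ∈ Ioo a b) :
    Tendsto (fun τ => (b - τ) * (X1 τ / (X τ - X t))) (𝓝[<] b) (𝓝 0) := by
  have hmono := strictMonoOn_of_hasDerivAt_pos h1 hpos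
  obtain ⟨t', ht', hb⟩ := exists_between ht.2
  have htm : t' ∈ Ioo a b := ⟨ht.1.trans ht', hb⟩
  have hd : 0 < X t' - X t := sub_pos.2 (hmono ht htm ht')
  have hlim := (tendsto_sub_nhdsLT b).mul_const (C / (X t' - X t))
  rw [zero_mul] at hlim
  refine squeeze_zero' ?_ ?_ hlim
  all_goals
    filter_upwards [hC, Ioo_mem_nhdsLT hb] with τ hτ hτ'
    have hτm : τ ∈ Ioo a b := ⟨htm.1.trans hτ'.1, hτ'.2⟩
    have hle : X t' - X t ≤ X τ - X t := sub_le_sub_right (hmono htm hτm hτ'.1).le _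
    have hp := hpos τ hτm
    have hbτ : 0 < b - τ := sub_pos.2 hτ'.2
  · exact mul_nonneg hbτ.le (div_nonneg hp.le (hd.le.trans hle))
  · exact mul_le_mul_of_nonneg_left (div_le_div₀ (hp.le.trans hτ) hτ hd hle) hbτ.le

/-- A positive function whose logarithmic derivative is asymptotic to `p / (b - τ)`, `p > 0`,
diverges at `b`. -/
theorem tendsto_atTop_of_logDeriv {X X1 : ℝ → ℝ} {b p : ℝ} (hp : 0 < p)
    (h1 : ∀ᶠ t in 𝓝[<] b, HasDerivAt X (X1 t) t) (hX : ∀ᶠ t in 𝓝[<] b, 0 < X t)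
    (hlim : Tendsto (fun τ => (b - τ) * (X1 τ / X τ)) (𝓝[<] b) (𝓝 p)) :
    Tendsto X (𝓝[<] b) atTop := by
  obtain ⟨c, hcb, hc⟩ := (mem_nhdsLT_iff_exists_Ioo_subset' (show b - 1 < b by linarith)).1
    (h1.and (hX.and (hlim.eventually (lt_mem_nhds (half_lt_self hp)))))
  -- Where `X'/X > (p/2)/(b - t)`, the function `log X + (p/2) log (b - t)` increases, so `log X`
  -- dominates `-(p/2) log (b - t)` up to a constant.
  have hder : ∀ t ∈ Ioo c b, HasDerivAt (fun t => Real.log (X t) + p / 2 * Real.log (b - t))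
      (X1 t / X t + p / 2 * (-1 / (b - t))) t := fun t ht =>
    ((hc ht).1.log (hc ht).2.1.ne').add
      ((((hasDerivAt_id t).const_sub b).log (sub_pos.2 ht.2).ne').const_mul (p / 2))
  have hmono : MonotoneOn (fun t => Real.log (X t) + p / 2 * Real.log (b - t)) (Ioo c b) := by
    refine monotoneOn_of_deriv_nonneg (convex_Ioo c b)
      (fun t ht => (hder t ht).continuousAt.continuousWithinAt) ?_ ?_
    all_goals
      intro t ht
      rw [interior_Ioo] at ht
    · exact (hder t ht).differentiableAt.differentiableWithinAt
    · rw [(hder t ht).deriv]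
      have hb : 0 < b - t := sub_pos.2 ht.2
      have h := (hc ht).2.2
      rw [mul_comm, ← div_lt_iff₀ hb] at h
      have e : p / 2 * (-1 / (b - t)) = -(p / 2 / (b - t)) := by ring
      rw [e]
      linarith
  obtain ⟨t₁, ht₁⟩ := exists_between (show c < b from hcb)
  have hlog : Tendsto (fun τ => Real.log (b - τ)) (𝓝[<] b) atBot := by
    refine Real.tendsto_log_nhdsGT_zero.comp (tendsto_nhdsWithin_iff.2
      ⟨tendsto_sub_nhdsLT b, ?_⟩)
    filter_upwards [self_mem_nhdsWithin] with τ hτ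
    exact sub_pos.2 (mem_Iio.1 hτ)
  have hlow : Tendsto (fun τ => (Real.log (X t₁) + p / 2 * Real.log (b - t₁)) +
      -(p / 2 * Real.log (b - τ))) (𝓝[<] b) atTop :=
    tendsto_atTop_add_const_left _ _
      (tendsto_neg_atBot_atTop.comp (hlog.const_mul_atBot (half_pos hp)))
  have hlogX : Tendsto (fun τ => Real.log (X τ)) (𝓝[<] b) atTop := by
    refine tendsto_atTop_mono' _ ?_ hlow
    filter_upwards [Ioo_mem_nhdsLT ht₁.2] with τ hτ
    have := hmono ht₁ ⟨ht₁.1.trans hτ.1, hτ.2⟩ hτ.1.le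
    simp only at this
    linarith
  refine (Real.tendsto_exp_atTop.comp hlogX).congr' ?_
  filter_upwards [hX] with τ hτ
  exact Real.exp_log hτ

/-! ### Null coordinates along the geodesic and their limits. -/

namespace GenRN

namespace IsGeodesicToCauchyHorizon

variable {S : GenRN} {ε a b : ℝ} {x : ℝ → ℝ × ℝ}

section Local

variable {t : ℝ}

theorem hasDerivAt_fst (hx : S.IsGeodesicToCauchyHorizon ε a b x) (ht : t ∈ Ioo a b) :
    HasDerivAt (fun t => (x t).1) (velocity x t).1 t := (hx.geodesic t ht).diff_v.hasDerivAt

theorem hasDerivAt_snd (hx : S.IsGeodesicToCauchyHorizon ε a b x) (ht : t ∈ Ioo a b) :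
    HasDerivAt (fun t => (x t).2) (velocity x t).2 t := (hx.geodesic t ht).diff_r.hasDerivAt

theorem radius_pos (hx : S.IsGeodesicToCauchyHorizon ε a b x) (ht : t ∈ Ioo a b) :
    0 < (x t).2 := S.rm_pos.trans (hx.region t ht)

theorem velocity_fst_pos (hx : S.IsGeodesicToCauchyHorizon ε a b x) (ht : t ∈ Ioo a b) :
    0 < (velocity x t).1 := by
  have := hx.future t ht
  simp only [metric] at this
  linarith

theorem energy_eq (hx : S.IsGeodesicToCauchyHorizon ε a b x) (ht : t ∈ Ioo a b) :
    S.F (x t).2 * (velocity x t).1 - (velocity x t).2 = ε := by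
  have := hx.energy t ht
  simp only [metric] at this
  linarith

theorem velocity_fst_mul (hx : S.IsGeodesicToCauchyHorizon ε a b x) (ht : t ∈ Ioo a b) :
    (velocity x t).1 * (2 * (velocity x t).2 - S.F (x t).2 * (velocity x t).1) = -1 := by
  have := hx.proper_time t ht
  simp only [metric] at this
  linarith

theorem hasDerivAt_F_comp (hx : S.IsGeodesicToCauchyHorizon ε a b x) (ht : t ∈ Ioo a b) :
    HasDerivAt (fun t => S.F (x t).2) (deriv S.F (x t).2 * (velocity x t).2) t :=
  (S.hasDerivAt_F (hx.radius_pos ht)).comp t (hx.hasDerivAt_snd ht)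

theorem differentiableAt_deriv_F_comp (hx : S.IsGeodesicToCauchyHorizon ε a b x)
    (ht : t ∈ Ioo a b) : DifferentiableAt ℝ (fun t => deriv S.F (x t).2) t :=
  DifferentiableAt.comp t (S.differentiableAt_deriv_F (hx.radius_pos ht))
    (hx.hasDerivAt_snd ht).differentiableAt

/-- `F v̇ = ṙ + ε` has the derivative `r̈ = -F'/2`. -/
theorem hasDerivAt_F_mul_velocity (hx : S.IsGeodesicToCauchyHorizon ε a b x) (ht : t ∈ Ioo a b) :
    HasDerivAt (fun t => S.F (x t).2 * (velocity x t).1) (-(deriv S.F (x t).2 / 2)) t := by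
  refine ((hx.hasDerivAt_F_comp ht).mul (hx.geodesic t ht).eq_v).congr_deriv ?_
  linear_combination deriv S.F (x t).2 / 2 * hx.velocity_fst_mul ht

/-- The derivative of the Kruskal coordinate `U` along the worldline. -/
noncomputable def _root_.GenRN.kruskalURate (S : GenRN) (x : ℝ → ℝ × ℝ) (t : ℝ) : ℝ :=
  Real.exp (-(S.kappaP * (x t).1)) * (S.kruskalProductDeriv (x t).2 * (velocity x t).2 -
    S.kappaP * S.kruskalProduct (x t).2 * (velocity x t).1)

theorem hasDerivAt_kruskalU (hx : S.IsGeodesicToCauchyHorizon ε a b x) (ht : t ∈ Ioo a b) :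
    HasDerivAt (fun t => S.kruskalU (x t)) (kruskalURate S x t) t := by
  have e1 := (S.hasDerivAt_kruskalProduct (hx.region t ht)).comp t (hx.hasDerivAt_snd ht)
  have e2 := ((hx.hasDerivAt_fst ht).const_mul S.kappaP).neg.exp
  refine (e1.mul e2).congr_deriv ?_
  simp only [kruskalURate, Function.comp_apply, Pi.neg_apply]
  ring

/-- The switch-on may occur in the exterior, so `U'` has to be continuous across the event horizon
as well; `U''` is needed only near the Cauchy horizon. -/
theorem continuousAt_kruskalURate (hx : S.IsGeodesicToCauchyHorizon ε a b x) (ht : t ∈ Ioo a b) :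
    ContinuousAt (kruskalURate S x) t := by
  have hr := (hx.hasDerivAt_snd ht).continuousAt
  have hG := ContinuousAt.comp (f := fun t => (x t).2)
    (S.continuousAt_kruskalProductDeriv (hx.region t ht)) hr
  have hG' := ContinuousAt.comp (f := fun t => (x t).2)
    (S.hasDerivAt_kruskalProduct (hx.region t ht)).continuousAt hr
  refine ((hx.hasDerivAt_fst ht).continuousAt.const_mul S.kappaP).neg.rexp.mul
    ((hG.mul (hx.geodesic t ht).eq_r.continuousAt).sub
    ((continuousAt_const.mul hG').mul (hx.geodesic t ht).eq_v.continuousAt))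

/-- Off the horizon `F G' = 2κ₊G`, so the bracket is `κ₊ G (2ṙ - F v̇)/F`, and proper time gives `v̇
(2ṙ - F v̇) = -1`. -/
theorem kruskalURate_eq (hx : S.IsGeodesicToCauchyHorizon ε a b x) (ht : t ∈ Ioo a b)
    (hr : (x t).2 ≠ S.rp) :
    kruskalURate S x t = -(S.kappaP * S.kruskalU (x t)) / (S.F (x t).2 * (velocity x t).1) := by
  have hF := S.F_ne_zero (hx.region t ht) hr
  have hv := (hx.velocity_fst_pos ht).ne'
  rw [kruskalURate, S.kruskalProductDeriv_eq (hx.region t ht) hr, kruskalU]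
  field_simp
  linear_combination S.kappaP * S.kruskalProduct (x t).2 * hx.velocity_fst_mul ht

/-- `U` and `F` have opposite signs on either side of `r₊`; at `r₊` itself `ṙ = -ε` and `G' = -1`,
so `U'` is a positive multiple of `ε`. -/
theorem kruskalURate_pos (hx : S.IsGeodesicToCauchyHorizon ε a b x) (hε : 0 < ε)
    (ht : t ∈ Ioo a b) : 0 < kruskalURate S x t := by
  have hκ := S.kappaP_pos
  have hv := hx.velocity_fst_pos ht
  rcases lt_trichotomy (x t).2 S.rp with h | h | h
  · rw [hx.kruskalURate_eq ht h.ne]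
    have hF := S.neg_between _ (hx.region t ht) h
    have hU : 0 < S.kruskalU (x t) := mul_pos (S.kruskalProduct_pos h) (Real.exp_pos _)
    exact div_pos_of_neg_of_neg (neg_neg_of_pos (mul_pos hκ hU)) (mul_neg_of_neg_of_pos hF hv)
  · have he := hx.energy_eq ht
    rw [h, S.F_rp, zero_mul] at he
    rw [kruskalURate, h, S.kruskalProductDeriv_rp, S.kruskalProduct_rp]
    refine mul_pos (Real.exp_pos _) ?_
    linarith
  · rw [hx.kruskalURate_eq ht h.ne']
    have hF := S.pos_exterior _ h
    have hU : S.kruskalU (x t) < 0 :=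
      mul_neg_of_neg_of_pos (S.kruskalProduct_neg h) (Real.exp_pos _)
    exact div_pos (neg_pos.2 (mul_neg_of_pos_of_neg hκ hU)) (mul_pos hF hv)

/-- The second derivative of `U` along the worldline, in the black hole region. -/
noncomputable def _root_.GenRN.kruskalURate₂ (S : GenRN) (x : ℝ → ℝ × ℝ) (t : ℝ) : ℝ :=
  kruskalURate S x t * (deriv S.F (x t).2 / 2 - S.kappaP) / (S.F (x t).2 * (velocity x t).1)

theorem hasDerivAt_kruskalURate (hx : S.IsGeodesicToCauchyHorizon ε a b x) (ht : t ∈ Ioo a b)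
    (hr : (x t).2 < S.rp) : HasDerivAt (kruskalURate S x) (kruskalURate₂ S x t) t := by
  have hF := S.F_ne_zero (hx.region t ht) hr.ne
  have hv := (hx.velocity_fst_pos ht).ne'
  have e := ((hx.hasDerivAt_kruskalU ht).const_mul S.kappaP).neg.div
    (hx.hasDerivAt_F_mul_velocity ht) (mul_ne_zero hF hv)
  refine (e.congr_of_eventuallyEq ?_).congr_deriv ?_
  · filter_upwards [(hx.hasDerivAt_snd ht).continuousAt.eventually (gt_mem_nhds hr),
      Ioo_mem_nhds ht.1 ht.2] with s hs hs'
    exact hx.kruskalURate_eq hs' hs.ne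
  · rw [kruskalURate₂, hx.kruskalURate_eq ht hr.ne]
    simp only [Pi.neg_apply]
    field_simp
    ring

theorem differentiableAt_kruskalURate₂ (hx : S.IsGeodesicToCauchyHorizon ε a b x)
    (ht : t ∈ Ioo a b) (hr : (x t).2 < S.rp) : DifferentiableAt ℝ (kruskalURate₂ S x) t := by
  have hq : S.F (x t).2 * (velocity x t).1 ≠ 0 :=
    mul_ne_zero (S.F_ne_zero (hx.region t ht) hr.ne) (hx.velocity_fst_pos ht).ne'
  exact ((hx.hasDerivAt_kruskalURate ht hr).differentiableAt.mul
    (((hx.differentiableAt_deriv_F_comp ht).div_const 2).sub_const _)).div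
    (hx.hasDerivAt_F_mul_velocity ht).differentiableAt hq

end Local

section Limits

theorem eventually_mem (hτ : a < b) : ∀ᶠ t in 𝓝[<] b, t ∈ Ioo a b := Ioo_mem_nhdsLT hτ

theorem eventually_lt_rp (hx : S.IsGeodesicToCauchyHorizon ε a b x) :
    ∀ᶠ t in 𝓝[<] b, (x t).2 < S.rp :=
  hx.approach.eventually (gt_mem_nhds S.rm_lt_rp)

/-- Energy and normalisation give `v̇ (2ε - F v̇) = 1`; as `F < 0` this yields `v̇ ≤ 1/(2ε)`, so `F
v̇` vanishes with `F`. -/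
theorem tendsto_F_mul_velocity (hx : S.IsGeodesicToCauchyHorizon ε a b x) (hε : 0 < ε)
    (hab : a < b) : Tendsto (fun t => S.F (x t).2 * (velocity x t).1) (𝓝[<] b) (𝓝 0) := by
  have hF : Tendsto (fun t => |S.F (x t).2| * (1 / (2 * ε))) (𝓝[<] b) (𝓝 0) := by
    have := (((S.hasDerivAt_F S.rm_pos).continuousAt.tendsto.comp hx.approach).abs).mul_const
      (1 / (2 * ε))
    rwa [S.F_rm, abs_zero, zero_mul] at this
  refine squeeze_zero_norm' ?_ hF
  filter_upwards [Ioo_mem_nhdsLT hab, hx.eventually_lt_rp] with t ht hr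
  have hv := hx.velocity_fst_pos ht
  rw [norm_mul, Real.norm_eq_abs, Real.norm_eq_abs, abs_of_pos hv]
  refine mul_le_mul_of_nonneg_left ?_ (abs_nonneg _)
  rw [le_div_iff₀ (by positivity)]
  have h1 := hx.energy_eq ht
  have h2 := hx.velocity_fst_mul ht
  have h3 := S.neg_between _ (hx.region t ht) hr
  have h4 : S.F (x t).2 * (velocity x t).1 * (velocity x t).1 < 0 :=
    mul_neg_of_neg_of_pos (mul_neg_of_neg_of_pos h3 hv) hv
  rw [show (velocity x t).2 = S.F (x t).2 * (velocity x t).1 - ε by linarith] at h2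
  linarith

theorem tendsto_velocity_fst (hx : S.IsGeodesicToCauchyHorizon ε a b x) (hε : 0 < ε)
    (hab : a < b) : Tendsto (fun t => (velocity x t).1) (𝓝[<] b) (𝓝 (1 / (2 * ε))) := by
  have h := ((hx.tendsto_F_mul_velocity hε hab).const_sub (2 * ε)).inv₀
    (by rw [sub_zero]; positivity)
  rw [sub_zero, ← one_div] at h
  refine h.congr' ?_
  filter_upwards [Ioo_mem_nhdsLT hab] with t ht
  refine inv_eq_of_mul_eq_one_left ?_
  have h1 := hx.energy_eq ht
  have h2 := hx.velocity_fst_mul ht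
  rw [show (velocity x t).2 = S.F (x t).2 * (velocity x t).1 - ε by linarith] at h2
  linarith

theorem tendsto_deriv_F (hx : S.IsGeodesicToCauchyHorizon ε a b x) :
    Tendsto (fun t => deriv S.F (x t).2 / 2) (𝓝[<] b) (𝓝 S.kappaM) :=
  ((S.differentiableAt_deriv_F S.rm_pos).continuousAt.tendsto.comp hx.approach).div_const 2

/-- L'Hôpital with `(F v̇)' = -F'/2 → -κ₋`; this is where the inner surface gravity enters the rate.
-/
theorem tendsto_sub_div_F_mul_velocity (hx : S.IsGeodesicToCauchyHorizon ε a b x) (hε : 0 < ε)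
    (hab : a < b) :
    Tendsto (fun t => (b - t) / (S.F (x t).2 * (velocity x t).1)) (𝓝[<] b)
      (𝓝 (1 / S.kappaM)) := by
  have hlim := hx.tendsto_deriv_F.inv₀ S.kappaM_neg.ne
  refine HasDerivAt.lhopital_zero_nhdsLT (f' := fun _ => -1)
    (g' := fun t => -(deriv S.F (x t).2 / 2))
    (Eventually.of_forall fun t => (hasDerivAt_id t).const_sub b)
    ((eventually_mem hab).mono fun t ht => hx.hasDerivAt_F_mul_velocity ht) ?_
    (tendsto_sub_nhdsLT b) (hx.tendsto_F_mul_velocity hε hab) ?_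
  · filter_upwards [hx.tendsto_deriv_F.eventually (gt_mem_nhds S.kappaM_neg)] with t ht
    exact (neg_pos.2 ht).ne'
  · rw [one_div]
    refine hlim.congr fun t => ?_
    rw [neg_div_neg_eq, one_div]

theorem tendsto_kruskalURate_div (hx : S.IsGeodesicToCauchyHorizon ε a b x) (hε : 0 < ε)
    (hab : a < b) :
    Tendsto (fun t => (b - t) * (kruskalURate S x t / S.kruskalU (x t))) (𝓝[<] b)
      (𝓝 (-(S.kappaP / S.kappaM))) := by
  have h := (hx.tendsto_sub_div_F_mul_velocity hε hab).const_mul (-S.kappaP)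
  rw [show -S.kappaP * (1 / S.kappaM) = -(S.kappaP / S.kappaM) by ring] at h
  refine h.congr' ?_
  filter_upwards [eventually_mem hab, hx.eventually_lt_rp] with t ht hr
  have hU : S.kruskalU (x t) ≠ 0 := (mul_pos (S.kruskalProduct_pos hr) (Real.exp_pos _)).ne'
  have hF := S.F_ne_zero (hx.region t ht) hr.ne
  have hv := (hx.velocity_fst_pos ht).ne'
  rw [hx.kruskalURate_eq ht hr.ne]
  field_simp

theorem tendsto_kruskalU (hx : S.IsGeodesicToCauchyHorizon ε a b x) (hε : 0 < ε)
    (hab : a < b) : Tendsto (fun t => S.kruskalU (x t)) (𝓝[<] b) atTop := by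
  refine tendsto_atTop_of_logDeriv (neg_pos.2 (div_neg_of_pos_of_neg S.kappaP_pos S.kappaM_neg))
    ((eventually_mem hab).mono fun t ht => hx.hasDerivAt_kruskalU ht) ?_
    (hx.tendsto_kruskalURate_div hε hab)
  filter_upwards [hx.eventually_lt_rp] with t hr
  exact mul_pos (S.kruskalProduct_pos hr) (Real.exp_pos _)

theorem tendsto_integral_kruskalU (hx : S.IsGeodesicToCauchyHorizon ε a b x) (hε : 0 < ε)
    {τ₀ : ℝ} (hτ₀ : τ₀ ∈ Ioo a b) (E : ℝ) :
    (∀ᶠ τ in 𝓝[<] b, IntervalIntegrable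
      (fun s => Real.cos (E * s) *
        nullKernel (fun t => S.kruskalU (x t)) (kruskalURate S x) τ s - 1 / s ^ 2)
        volume 0 (τ - τ₀)) ∧
    Tendsto (fun τ => (b - τ) * ∫ s in (0 : ℝ)..(τ - τ₀), (Real.cos (E * s) *
        nullKernel (fun t => S.kruskalU (x t)) (kruskalURate S x) τ s - 1 / s ^ 2))
      (𝓝[<] b) (𝓝 ((1 + S.kappaP / S.kappaM) / 2)) := by
  have hab : a < b := hτ₀.1.trans hτ₀.2
  have hκ := S.kappaM_neg.ne
  -- The right side is `β/2 - α` with `β = (κ₋ - κ₊)/κ₋` and `α = -κ₊/κ₋`.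
  have e : (1 + S.kappaP / S.kappaM) / 2 =
      (1 / S.kappaM * (S.kappaM - S.kappaP)) / 2 - -(S.kappaP / S.kappaM) := by
    field_simp; ring
  rw [e]
  refine tendsto_integral_cos_mul_nullKernel (X2 := kruskalURate₂ S x) E hτ₀
    (fun t ht => hx.hasDerivAt_kruskalU ht)
    (fun t ht => (hx.continuousAt_kruskalURate ht).continuousWithinAt)
    (fun t ht => hx.kruskalURate_pos hε ht) ?_ ?_ ?_ ?_
  · filter_upwards [eventually_mem hab, hx.eventually_lt_rp] with t ht hr
    exact hx.hasDerivAt_kruskalURate ht hr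
  · filter_upwards [eventually_mem hab, hx.eventually_lt_rp] with t ht hr
    exact hx.differentiableAt_kruskalURate₂ ht hr
  · intro t ht
    -- Since `U → ∞`, replacing `U(τ)` by `U(τ) - U(t)` does not change the limit, so `α` is
    -- independent of `t`.
    have h1 := (hx.tendsto_kruskalU hε hab).const_div_atTop (S.kruskalU (x t))
    have h2 := (h1.const_sub 1).inv₀ (by norm_num)
    have h3 := (hx.tendsto_kruskalURate_div hε hab).mul h2
    rw [sub_zero, inv_one, mul_one] at h3
    refine h3.congr' ?_
    filter_upwards [(hx.tendsto_kruskalU hε hab).eventually_gt_atTop 0,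
      (hx.tendsto_kruskalU hε hab).eventually_gt_atTop (S.kruskalU (x t))] with τ hτ hτ'
    have h4 : S.kruskalU (x τ) - S.kruskalU (x t) ≠ 0 := (sub_pos.2 hτ').ne'
    rw [one_sub_div hτ.ne', inv_div]
    field_simp
  · refine ((hx.tendsto_sub_div_F_mul_velocity hε hab).mul
      (hx.tendsto_deriv_F.sub_const S.kappaP)).congr' ?_
    filter_upwards [eventually_mem hab] with t ht
    have := (hx.kruskalURate_pos hε ht).ne'
    rw [kruskalURate₂]
    field_simp

theorem tendsto_integral_fst (hx : S.IsGeodesicToCauchyHorizon ε a b x) (hε : 0 < ε)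
    {τ₀ : ℝ} (hτ₀ : τ₀ ∈ Ioo a b) (E : ℝ) :
    (∀ᶠ τ in 𝓝[<] b, IntervalIntegrable
      (fun s => Real.cos (E * s) *
        nullKernel (fun t => (x t).1) (fun t => (velocity x t).1) τ s - 1 / s ^ 2)
        volume 0 (τ - τ₀)) ∧
    Tendsto (fun τ => (b - τ) * ∫ s in (0 : ℝ)..(τ - τ₀), (Real.cos (E * s) *
        nullKernel (fun t => (x t).1) (fun t => (velocity x t).1) τ s - 1 / s ^ 2))
      (𝓝[<] b) (𝓝 0) := by
  have hab : a < b := hτ₀.1.trans hτ₀.2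
  have hv := hx.tendsto_velocity_fst hε hab
  have key := tendsto_integral_cos_mul_nullKernel (α := 0) (β := 0)
    (X2 := fun t => -(deriv S.F (x t).2 / 2) * (velocity x t).1 ^ 2) E hτ₀
    (fun t ht => hx.hasDerivAt_fst ht)
    (fun t ht => (hx.geodesic t ht).eq_v.continuousAt.continuousWithinAt)
    (fun t ht => hx.velocity_fst_pos ht)
    ((eventually_mem hab).mono fun t ht => (hx.geodesic t ht).eq_v)
    ((eventually_mem hab).mono fun t ht =>
      ((hx.differentiableAt_deriv_F_comp ht).div_const 2).neg.mul
        ((hx.geodesic t ht).eq_v.differentiableAt.pow 2))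
    (fun t ht => tendsto_mul_div_sub_of_bounded (fun t ht => hx.hasDerivAt_fst ht)
      (fun t ht => hx.velocity_fst_pos ht)
      ((hv.eventually (gt_mem_nhds (lt_add_one _))).mono fun _ h => h.le) ht) ?_
  · simpa using key
  · have h := (tendsto_sub_nhdsLT b).mul (hx.tendsto_deriv_F.neg.mul hv)
    rw [zero_mul] at h
    refine h.congr' ?_
    filter_upwards [eventually_mem hab] with t ht
    have := (hx.velocity_fst_pos ht).ne'
    field_simp

/-- Bounded `v̇` over finite proper time; needed to bound `V'`. -/
theorem exists_fst_le (hx : S.IsGeodesicToCauchyHorizon ε a b x) (hε : 0 < ε) (hab : a < b) :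
    ∃ C, ∀ᶠ t in 𝓝[<] b, (x t).1 ≤ C := by
  obtain ⟨c, hcb, hc⟩ := (mem_nhdsLT_iff_exists_Ioo_subset' hab).1
    ((eventually_mem hab).and ((hx.tendsto_velocity_fst hε hab).eventually
      (gt_mem_nhds (lt_add_one _))))
  set M := 1 / (2 * ε) + 1
  have hM : 0 ≤ M := by positivity
  obtain ⟨t₁, ht₁⟩ := exists_between (show c < b from hcb)
  refine ⟨(x t₁).1 + M * (b - t₁), ?_⟩
  filter_upwards [Ioo_mem_nhdsLT ht₁.2] with t ht
  have key := Convex.image_sub_le_mul_sub_of_deriv_le (convex_Ioo c b) (f := fun t => (x t).1)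
    (fun s hs => (hx.hasDerivAt_fst (hc hs).1).continuousAt.continuousWithinAt)
    (fun s hs => by
      rw [interior_Ioo] at hs
      exact (hx.hasDerivAt_fst (hc hs).1).differentiableAt.differentiableWithinAt)
    (C := M) (fun s hs => by
      rw [interior_Ioo] at hs
      rw [(hx.hasDerivAt_fst (hc hs).1).deriv]
      exact (hc hs).2.le)
    t₁ ht₁ t ⟨ht₁.1.trans ht.1, ht.2⟩ ht.1.le
  have : M * (t - t₁) ≤ M * (b - t₁) := mul_le_mul_of_nonneg_left (by linarith [ht.2]) hM
  linarith

/-- The derivative of the Kruskal coordinate `V` along the worldline. -/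
noncomputable def _root_.GenRN.kruskalVRate (S : GenRN) (x : ℝ → ℝ × ℝ) (t : ℝ) : ℝ :=
  S.kruskalV (x t) * (S.kappaP * (velocity x t).1)

theorem hasDerivAt_kruskalV (hx : S.IsGeodesicToCauchyHorizon ε a b x) {t : ℝ}
    (ht : t ∈ Ioo a b) : HasDerivAt (fun t => S.kruskalV (x t)) (kruskalVRate S x t) t :=
  ((hx.hasDerivAt_fst ht).const_mul S.kappaP).exp

theorem kruskalVRate_pos (hx : S.IsGeodesicToCauchyHorizon ε a b x) {t : ℝ}
    (ht : t ∈ Ioo a b) : 0 < kruskalVRate S x t :=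
  mul_pos (Real.exp_pos _) (mul_pos S.kappaP_pos (hx.velocity_fst_pos ht))

theorem hasDerivAt_kruskalVRate (hx : S.IsGeodesicToCauchyHorizon ε a b x) {t : ℝ}
    (ht : t ∈ Ioo a b) : HasDerivAt (kruskalVRate S x)
      (kruskalVRate S x t * ((S.kappaP - deriv S.F (x t).2 / 2) * (velocity x t).1)) t := by
  refine ((hx.hasDerivAt_kruskalV ht).mul
    ((hx.geodesic t ht).eq_v.const_mul S.kappaP)).congr_deriv ?_
  simp only [kruskalVRate]
  ring

theorem tendsto_integral_kruskalV (hx : S.IsGeodesicToCauchyHorizon ε a b x) (hε : 0 < ε)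
    {τ₀ : ℝ} (hτ₀ : τ₀ ∈ Ioo a b) (E : ℝ) :
    (∀ᶠ τ in 𝓝[<] b, IntervalIntegrable
      (fun s => Real.cos (E * s) *
        nullKernel (fun t => S.kruskalV (x t)) (kruskalVRate S x) τ s - 1 / s ^ 2)
        volume 0 (τ - τ₀)) ∧
    Tendsto (fun τ => (b - τ) * ∫ s in (0 : ℝ)..(τ - τ₀), (Real.cos (E * s) *
        nullKernel (fun t => S.kruskalV (x t)) (kruskalVRate S x) τ s - 1 / s ^ 2))
      (𝓝[<] b) (𝓝 0) := by
  have hab : a < b := hτ₀.1.trans hτ₀.2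
  have hκ := S.kappaP_pos
  have hv := hx.tendsto_velocity_fst hε hab
  obtain ⟨C, hC⟩ := hx.exists_fst_le hε hab
  have hbound : ∀ᶠ t in 𝓝[<] b,
      kruskalVRate S x t ≤ Real.exp (S.kappaP * C) * (S.kappaP * (1 / (2 * ε) + 1)) := by
    filter_upwards [hC, eventually_mem hab, hv.eventually (gt_mem_nhds (lt_add_one _))]
      with t h1 h2 h3
    have hp := hx.velocity_fst_pos h2
    unfold kruskalVRate kruskalV
    gcongr
  have key := tendsto_integral_cos_mul_nullKernel (α := 0) (β := 0)
    (X2 := fun t => kruskalVRate S x t *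
      ((S.kappaP - deriv S.F (x t).2 / 2) * (velocity x t).1)) E hτ₀
    (fun t ht => hx.hasDerivAt_kruskalV ht)
    (fun t ht => (hx.hasDerivAt_kruskalVRate ht).continuousAt.continuousWithinAt)
    (fun t ht => hx.kruskalVRate_pos ht)
    ((eventually_mem hab).mono fun t ht => hx.hasDerivAt_kruskalVRate ht)
    ((eventually_mem hab).mono fun t ht =>
      (hx.hasDerivAt_kruskalVRate ht).differentiableAt.mul
        ((((hx.differentiableAt_deriv_F_comp ht).div_const 2).const_sub _).mul
        (hx.geodesic t ht).eq_v.differentiableAt))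
    (fun t ht => tendsto_mul_div_sub_of_bounded (fun t ht => hx.hasDerivAt_kruskalV ht)
      (fun t ht => hx.kruskalVRate_pos ht) hbound ht) ?_
  · simpa using key
  · have h := (tendsto_sub_nhdsLT b).mul ((hx.tendsto_deriv_F.const_sub S.kappaP).mul hv)
    rw [zero_mul] at h
    refine h.congr' ?_
    filter_upwards [eventually_mem hab] with t ht
    rw [mul_div_cancel_left₀ _ (hx.kruskalVRate_pos ht).ne']

end Limits

end IsGeodesicToCauchyHorizon

end GenRN

/-! ### From the two-point function to the transition rate. -/

/-- For real `f ≠ 0` of either sign, `i f` avoids the branch cut, and the factor `i` cancels in the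
logarithmic derivative. -/
theorem HasDerivAt.clog_I_mul {f : ℝ → ℝ} {f' t : ℝ} (hf : HasDerivAt f f' t) (h0 : f t ≠ 0) :
    HasDerivAt (fun t => Complex.log (Complex.I * f t)) ((f' / f t : ℝ) : ℂ) t := by
  have h1 : HasDerivAt (fun t => Complex.I * (f t : ℂ)) (Complex.I * (f' : ℂ)) t :=
    hf.ofReal_comp.const_mul Complex.I
  have hmem : Complex.I * (f t : ℂ) ∈ Complex.slitPlane := by
    rw [Complex.mem_slitPlane_iff]
    right
    simpa using h0
  refine (h1.clog_real hmem).congr_deriv ?_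
  rw [mul_div_mul_left _ _ Complex.I_ne_zero, Complex.ofReal_div]

namespace GenRN

section Detector

variable {X Y : ℝ × ℝ → ℝ} {x : ℝ → ℝ × ℝ} {X1 Y1 : ℝ → ℝ} {a b : ℝ}

theorem detectorCorrelation_vacuumTwoPoint (c : ℝ)
    (hX : ∀ t ∈ Ioo a b, HasDerivAt (fun t => X (x t)) (X1 t) t)
    (hX' : ∀ t ∈ Ioo a b, 0 < X1 t)
    (hY : ∀ t ∈ Ioo a b, HasDerivAt (fun t => Y (x t)) (Y1 t) t)
    (hY' : ∀ t ∈ Ioo a b, 0 < Y1 t) {τ₁ τ₂ : ℝ} (h₂ : a < τ₂) (h₂₁ : τ₂ < τ₁) (h₁ : τ₁ < b) :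
    detectorCorrelation (fun p q => vacuumTwoPoint c (X p - X q) (Y p - Y q)) x τ₁ τ₂ =
      ((-(1 / (4 * Real.pi)) * (nullKernel (fun t => X (x t)) X1 τ₁ (τ₁ - τ₂) +
        nullKernel (fun t => Y (x t)) Y1 τ₁ (τ₁ - τ₂)) : ℝ) : ℂ) := by
  have hm₂ : τ₂ ∈ Ioo a b := ⟨h₂, h₂₁.trans h₁⟩
  have hm₁ : τ₁ ∈ Ioo a b := ⟨h₂.trans h₂₁, h₁⟩
  have hXm := strictMonoOn_of_hasDerivAt_pos hX hX'
  have hYm := strictMonoOn_of_hasDerivAt_pos hY hY'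
  have hdX : ∀ t ∈ Ioo τ₂ b, X (x t) - X (x τ₂) ≠ 0 := fun t ht =>
    (sub_pos.2 (hXm hm₂ ⟨h₂.trans ht.1, ht.2⟩ ht.1)).ne'
  have hdY : ∀ t ∈ Ioo τ₂ b, Y (x t) - Y (x τ₂) ≠ 0 := fun t ht =>
    (sub_pos.2 (hYm hm₂ ⟨h₂.trans ht.1, ht.2⟩ ht.1)).ne'
  have inner : ∀ t ∈ Ioo τ₂ b,
      deriv (fun s => vacuumTwoPoint c (X (x t) - X (x s)) (Y (x t) - Y (x s))) τ₂ =
      ((1 / (4 * Real.pi) * (X1 τ₂ / (X (x t) - X (x τ₂)) + Y1 τ₂ / (Y (x t) - Y (x τ₂))) : ℝ)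
        : ℂ) := by
    intro t ht
    have e := ((((hX τ₂ hm₂).const_sub (X (x t))).clog_I_mul (hdX t ht)).add
      (((hY τ₂ hm₂).const_sub (Y (x t))).clog_I_mul (hdY t ht))).const_mul
      (-(1 / (4 * (Real.pi : ℂ))))
    have e' := (e.add_const (c : ℂ)).deriv
    refine Eq.trans e' ?_
    push_cast
    ring
  have outer : HasDerivAt (fun t => 1 / (4 * Real.pi) *
      (X1 τ₂ / (X (x t) - X (x τ₂)) + Y1 τ₂ / (Y (x t) - Y (x τ₂))))
      (-(1 / (4 * Real.pi)) * (nullKernel (fun t => X (x t)) X1 τ₁ (τ₁ - τ₂) +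
        nullKernel (fun t => Y (x t)) Y1 τ₁ (τ₁ - τ₂))) τ₁ := by
    have hτ₁ : τ₁ ∈ Ioo τ₂ b := ⟨h₂₁, h₁⟩
    have e1 := (hasDerivAt_const τ₁ (X1 τ₂)).div ((hX τ₁ hm₁).sub_const (X (x τ₂))) (hdX τ₁ hτ₁)
    have e2 := (hasDerivAt_const τ₁ (Y1 τ₂)).div ((hY τ₁ hm₁).sub_const (Y (x τ₂))) (hdY τ₁ hτ₁)
    refine ((e1.add e2).const_mul (1 / (4 * Real.pi))).congr_deriv ?_
    simp only [nullKernel, sub_sub_cancel]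
    ring
  unfold detectorCorrelation
  rw [← outer.ofReal_comp.deriv]
  -- The inner derivative is known only for `t > τ₂`, which is a neighbourhood statement at `τ₁` and
  -- suffices for the outer one.
  refine Filter.EventuallyEq.deriv_eq ?_
  filter_upwards [Ioo_mem_nhds h₂₁ h₁] with t ht
  exact inner t ht

/-- The counterterm is `-(1/4π)` times two copies of `-1/s²`, one for each null coordinate. -/
theorem rateIntegrand_vacuumTwoPoint (c E : ℝ)
    (hX : ∀ t ∈ Ioo a b, HasDerivAt (fun t => X (x t)) (X1 t) t)
    (hX' : ∀ t ∈ Ioo a b, 0 < X1 t)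
    (hY : ∀ t ∈ Ioo a b, HasDerivAt (fun t => Y (x t)) (Y1 t) t)
    (hY' : ∀ t ∈ Ioo a b, 0 < Y1 t) {τ s : ℝ} (hτ : τ < b) (hs : 0 < s) (hs' : a < τ - s) :
    rateIntegrand (fun p q => vacuumTwoPoint c (X p - X q) (Y p - Y q)) x E τ s =
      -(1 / (4 * Real.pi)) *
        ((Real.cos (E * s) * nullKernel (fun t => X (x t)) X1 τ s - 1 / s ^ 2) +
        (Real.cos (E * s) * nullKernel (fun t => Y (x t)) Y1 τ s - 1 / s ^ 2)) := by
  unfold rateIntegrand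
  rw [detectorCorrelation_vacuumTwoPoint c hX hX' hY hY' hs' (by linarith) hτ, sub_sub_cancel]
  have e1 : (Complex.exp (-(Complex.I * E * s))).re = Real.cos (E * s) := by
    rw [Complex.exp_re]
    simp
  have e2 : (1 / (2 * (Real.pi : ℂ) * (s : ℂ) ^ 2)) = ((1 / (2 * Real.pi * s ^ 2) : ℝ) : ℂ) := by
    push_cast; rfl
  rw [e2, Complex.add_re, Complex.ofReal_re, mul_comm (Complex.exp _), Complex.re_ofReal_mul, e1]
  have := Real.pi_pos.ne'
  have := hs.ne'
  field_simp
  ring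

theorem hasCauchyHorizonRate_of_tendsto (S : GenRN) (c E : ℝ) {τ₀ : ℝ} (hτ₀ : τ₀ ∈ Ioo a b)
    (hX : ∀ t ∈ Ioo a b, HasDerivAt (fun t => X (x t)) (X1 t) t)
    (hX' : ∀ t ∈ Ioo a b, 0 < X1 t)
    (hY : ∀ t ∈ Ioo a b, HasDerivAt (fun t => Y (x t)) (Y1 t) t)
    (hY' : ∀ t ∈ Ioo a b, 0 < Y1 t)
    (hIX : (∀ᶠ τ in 𝓝[<] b, IntervalIntegrable (fun s => Real.cos (E * s) *
        nullKernel (fun t => X (x t)) X1 τ s - 1 / s ^ 2) volume 0 (τ - τ₀)) ∧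
      Tendsto (fun τ => (b - τ) * ∫ s in (0 : ℝ)..(τ - τ₀), (Real.cos (E * s) *
        nullKernel (fun t => X (x t)) X1 τ s - 1 / s ^ 2)) (𝓝[<] b)
        (𝓝 ((1 + S.kappaP / S.kappaM) / 2)))
    (hIY : (∀ᶠ τ in 𝓝[<] b, IntervalIntegrable (fun s => Real.cos (E * s) *
        nullKernel (fun t => Y (x t)) Y1 τ s - 1 / s ^ 2) volume 0 (τ - τ₀)) ∧
      Tendsto (fun τ => (b - τ) * ∫ s in (0 : ℝ)..(τ - τ₀), (Real.cos (E * s) *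
        nullKernel (fun t => Y (x t)) Y1 τ s - 1 / s ^ 2)) (𝓝[<] b) (𝓝 0)) :
    S.HasCauchyHorizonRate (fun p q => vacuumTwoPoint c (X p - X q) (Y p - Y q)) x E τ₀ b := by
  have hπ := Real.pi_pos
  set W : ℝ × ℝ → ℝ × ℝ → ℂ := fun p q => vacuumTwoPoint c (X p - X q) (Y p - Y q)
  have heq : ∀ τ ∈ Ioo τ₀ b, EqOn (fun s => -(1 / (4 * Real.pi)) *
        ((Real.cos (E * s) * nullKernel (fun t => X (x t)) X1 τ s - 1 / s ^ 2) +
        (Real.cos (E * s) * nullKernel (fun t => Y (x t)) Y1 τ s - 1 / s ^ 2)))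
      (rateIntegrand W x E τ) (uIoc 0 (τ - τ₀)) := by
    intro τ hτ s hs
    rw [uIoc_of_le (by linarith [hτ.1])] at hs
    exact (rateIntegrand_vacuumTwoPoint c E hX hX' hY hY' hτ.2 hs.1
      (by linarith [hs.2, hτ₀.1])).symm
  have hev : ∀ᶠ τ in 𝓝[<] b, τ ∈ Ioo τ₀ b := Ioo_mem_nhdsLT hτ₀.2
  -- The error function is the asserted formula solved for `η`, so the formula holds identically and
  -- only the limit of `η` has content.
  refine ⟨?_, fun τ => -(4 * Real.pi) * ((b - τ) * transitionRate W x E τ τ₀) -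
    (1 + S.kappaP / S.kappaM), ?_, ?_⟩
  · filter_upwards [hev, hIX.1, hIY.1] with τ hτ h1 h2
    exact ((h1.add h2).const_mul _).congr (heq τ hτ)
  · have hinv : Tendsto (fun τ => 1 / (Real.pi * (τ - τ₀))) (𝓝[<] b)
        (𝓝 (1 / (Real.pi * (b - τ₀)))) := by
      have : ContinuousAt (fun τ => 1 / (Real.pi * (τ - τ₀))) b :=
        continuousAt_const.div (by fun_prop) (mul_pos hπ (sub_pos.2 hτ₀.2)).ne'
      exact this.tendsto.mono_left nhdsWithin_le_nhds
    have hlim := (((tendsto_sub_nhdsLT b).mul (hinv.const_add (-(E / 2)))).const_mul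
      (-(4 * Real.pi))).add ((hIX.2.add hIY.2).const_mul 2)
    have hlim' := hlim.sub_const (1 + S.kappaP / S.kappaM)
    rw [show -(4 * Real.pi) * (0 * (-(E / 2) + 1 / (Real.pi * (b - τ₀)))) +
      2 * ((1 + S.kappaP / S.kappaM) / 2 + 0) - (1 + S.kappaP / S.kappaM) = 0 by ring] at hlim'
    refine hlim'.congr' ?_
    filter_upwards [hev, hIX.1, hIY.1] with τ hτ h1 h2
    have hint : ∫ s in (0 : ℝ)..(τ - τ₀), rateIntegrand W x E τ s = -(1 / (4 * Real.pi)) *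
        ((∫ s in (0 : ℝ)..(τ - τ₀), (Real.cos (E * s) *
          nullKernel (fun t => X (x t)) X1 τ s - 1 / s ^ 2)) +
        ∫ s in (0 : ℝ)..(τ - τ₀), (Real.cos (E * s) *
          nullKernel (fun t => Y (x t)) Y1 τ s - 1 / s ^ 2)) := by
      rw [← intervalIntegral.integral_add h1 h2, ← intervalIntegral.integral_const_mul]
      refine intervalIntegral.integral_congr_ae (Eventually.of_forall fun s hs => ?_)
      exact (heq τ hτ hs).symm
    simp only [transitionRate]
    rw [hint]
    field_simp
    ring
  · intro τ hτ
    have : b - τ ≠ 0 := (sub_pos.2 hτ.2).ne'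
    field_simp
    ring

end Detector

end GenRN

theorem mainTheorem10 (S : GenRN) (ε a τ₀ τh E c : ℝ) (x : ℝ → ℝ × ℝ)
    (hε : 0 < ε) (hτ₀ : τ₀ ∈ Set.Ioo a τh)
    (hx : S.IsGeodesicToCauchyHorizon ε a τh x) :
    S.HasCauchyHorizonRate (S.wightmanHHI c) x E τ₀ τh ∧
      S.HasCauchyHorizonRate (S.wightmanUnruh c) x E τ₀ τh := by
  have hU : ∀ t ∈ Ioo a τh, HasDerivAt (fun t => S.kruskalU (x t))
      (S.kruskalURate x t) t :=
    fun t ht => hx.hasDerivAt_kruskalU ht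
  have hU' : ∀ t ∈ Ioo a τh, 0 < S.kruskalURate x t :=
    fun t ht => hx.kruskalURate_pos hε ht
  have hIU := hx.tendsto_integral_kruskalU hε hτ₀ E
  exact ⟨GenRN.hasCauchyHorizonRate_of_tendsto S c E hτ₀ hU hU'
      (fun t ht => hx.hasDerivAt_kruskalV ht) (fun t ht => hx.kruskalVRate_pos ht) hIU
      (hx.tendsto_integral_kruskalV hε hτ₀ E),
    GenRN.hasCauchyHorizonRate_of_tendsto (Y := Prod.fst) S c E hτ₀ hU hU'
      (fun t ht => hx.hasDerivAt_fst ht) (fun t ht => hx.velocity_fst_pos ht) hIU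
      (hx.tendsto_integral_fst hε hτ₀ E)⟩
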